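/- **Setting.** $\mathcal L$ is the language of arithmetic ($0,S,+,\cdot,=$), with finitely many further function symbols for elementary syntactic operations on Gödel numbers, extended by unary predicates $T$ and $P$. Formulas are built from the literals $s=t$, $s\neq t$, $Tt$, $\neg Tt$, $Pt$, $\neg Pt$ by $\wedge,\vee,\forall,\exists$; $\neg$ is extended to all formulas by De Morgan duality, with $\neg\neg\varphi:=\varphi$. $\#e$ is the Gödel number of an expression $e$, and $T\varphi$, $P\varphi$ inside formulas abbreviate $T\ulcorner\varphi\urcorner$, $P\ulcorner\varphi\urcorner$. The operation on codes that corresponds to a syntactic operation is written with a dot: $\dot\wedge$, $\dot\forall$, $\dot T$, $\dot P$, $\dot\neg$ (negation of formulas), and so on; for a code $s$ of a formula and a code $v$ of a variable, $s(\dot y)$ denotes the code of the result of substituting the numeral of $y$ for the variable $v$ in $s$. $\mathrm{val}$ is the evaluation function for codes of closed terms; it is expressed by an arithmetical formula that defines its graph in $\mathbb N$. $\mathrm{PA[SK]}$ is the two-sided sequent calculus for Strong Kleene logic with identity over $\mathcal L$ (initial sequents $\varphi\Rightarrow\varphi$; rules L$\neg$, Cut, weakening, left and right rules for $\wedge,\vee,\forall,\exists$,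 reflexivity, and replacement, i.e. from $\Gamma\Rightarrow\Delta,\varphi(t)$ infer $\Gamma\Rightarrow\Delta,s\neq t,\varphi(s)$), expanded by the initial sequents of Peano arithmetic (with the defining equations of the additional function symbols) and by the induction rule for all $\mathcal L$-formulas. $B(x)$ is an arithmetical formula that defines in $\mathbb N$ the set of base paradoxical sentences, i.e. of (codes of) sentences $\varphi$ such that $\varphi$ is $\mathrm{PA[SK]}$-equivalent to $\neg T\ulcorner\varphi\urcorner$: the sequents $\varphi\Leftrightarrow\neg T\ulcorner\varphi\urcorner$ and $\neg\varphi\Leftrightarrow\neg\neg T\ulcorner\varphi\urcorner$ are derivable. Put $\Pi(x):=B(x)\vee B(\dot\neg x)$. **The theories.** $\mathrm{TP}$ expands $\mathrm{PA[SK]}$ by the following initial sequents, for (codes of) sentences $\varphi,\psi,\forall x\varphi,\exists x\varphi$ and of closed terms $s,t$, which are represented by free variables that satisfy the corresponding predicate: * $(T_1)$ $\mathrm{val}(s)=\mathrm{val}(t)\Leftrightarrow T(s\mathbin{\dot=}t)$; $\ \mathrm{val}(s)\ne\mathrm{val}(t)\Leftrightarrow T(s\mathbin{\dot{\neq}}t)$.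 * $(T_2)$ $P\,\mathrm{val}(t)\Leftrightarrow T(\dot Pt)$; $\ \neg P\,\mathrm{val}(t)\Leftrightarrow T(\dot\neg\dot Pt)$. * $(T_3)$ $T\,\mathrm{val}(t)\Leftrightarrow T(\dot Tt)$; $\ T\neg\varphi\Leftrightarrow\neg T\varphi$. * $(T_4)$ $T\varphi\wedge T\psi\Leftrightarrow T(\varphi\wedge\psi)$; $\ T\varphi\vee T\psi\Leftrightarrow T(\varphi\vee\psi)$. * $(T_5)$ $\forall x\,T\varphi(\dot x)\Leftrightarrow T\forall x\varphi$; $\ \exists x\,T\varphi(\dot x)\Leftrightarrow T\exists x\varphi$. * $(P_1)$ $\Pi(\varphi)\Rightarrow P\varphi$. * $(P_2)$ $P(\dot\neg\dot Tt)\Leftrightarrow P(\dot Tt)$; $\ P(\dot\neg\dot Pt)\Leftrightarrow P(\dot Pt)$. * $(P_3)$ $P(\dot Tt)\Leftrightarrow P\,\mathrm{val}(t)\vee\Pi(\dot Tt)$. * $(P_4)$ $P(\varphi\wedge\psi)\Leftrightarrow(P\varphi\wedge P\psi)\vee(T\varphi\wedge P\psi)\vee(T\psi\wedge P\varphi)\vee\Pi(\varphi\wedge\psi)$.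 * $(P_5)$ $P(\varphi\vee\psi)\Leftrightarrow(P\varphi\wedge P\psi)\vee(\neg T\varphi\wedge P\psi)\vee(\neg T\psi\wedge P\varphi)\vee\Pi(\varphi\vee\psi)$. * $(P_6)$ $P\forall x\varphi\Leftrightarrow\big(\exists x\,P\varphi(\dot x)\wedge\forall y(P\varphi(\dot y)\vee T\varphi(\dot y))\big)\vee\Pi(\forall x\varphi)$. * $(P_7)$ $P\exists x\varphi\Leftrightarrow\big(\exists x\,P\varphi(\dot x)\wedge\forall y(P\varphi(\dot y)\vee\neg T\varphi(\dot y))\big)\vee\Pi(\exists x\varphi)$. * $(I_1)$ $T(\varphi\vee\neg\varphi)\Rightarrow\neg P\varphi$. $\mathrm{TP}^+$ is $\mathrm{TP}$ together with the initial sequents $\emptyset\Rightarrow\neg P(\dot Pt)$ for closed terms $t$. **The semantics.** An interpretation is a pair $(T,P)$ with $T=(T^+,T^-)$ and $P=(P^+,P^-)$ pairs of subsets of $\mathbb N$; interpretations are ordered by componentwise inclusion. $(\mathbb N,T,P)\vDash\varphi$ is Strong Kleene satisfaction over the standard model, with $T^+,P^+$ as extensions and $T^-,P^-$ as anti-extensions.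 $(\mathbb N,T,P)$ satisfies a sequent $\Gamma\Rightarrow\Delta$ if, for all values of the free variables, it satisfies some member of $\Delta$ whenever it satisfies all members of $\Gamma$; it is a model of a system if it satisfies every sequent derivable in the system. Let $\mathscr P(x)$ be the disjunction of the following formulas, each conjoined with "$x$ is a sentence": * $\Pi(x)$; * $\exists s\,(x=\dot Ts\wedge P\,\mathrm{val}(s))$ and $\exists s\,(x=\dot\neg\dot Ts\wedge P\,\mathrm{val}(s))$, with $s$ ranging over codes of closed terms; * $\exists y\exists z\,\big(x=y\mathbin{\dot\wedge}z\wedge[(Py\wedge Pz)\vee(Ty\wedge Pz)\vee(Tz\wedge Py)]\big)$; * $\exists y\exists z\,\big(x=y\mathbin{\dot\vee}z\wedge[(Py\wedge Pz)\vee(\neg Ty\wedge Pz)\vee(\neg Tz\wedge Py)]\big)$; * $\exists v\exists s\,\big(x=\dot\forall vs\wedge\exists y\,Ps(\dot y)\wedge\forall y(Ps(\dot y)\vee Ts(\dot y))\big)$; * $\exists v\exists s\,\big(x=\dot\exists vs\wedge\exists y\,Ps(\dot y)\wedge\forall y(Ps(\dot y)\vee\neg Ts(\dot y))\big)$. Let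 $P_0^{*-}:=\{\#(Pt)\mid t\text{ a closed term}\}$. The modified jump is $$\Gamma^*(T,P):=\Big(\big(\{\#\varphi\mid(\mathbb N,T,P)\vDash\varphi\},\{\#\varphi\mid(\mathbb N,T,P)\vDash\neg\varphi\}\big),\big(\{\#\varphi\mid(\mathbb N,T,P)\vDash\mathscr P(\ulcorner\varphi\urcorner)\},\{\#\varphi\mid(\mathbb N,T,P)\vDash\varphi\vee\neg\varphi\}\cup P_0^{*-}\big)\Big),$$ with $\varphi$ ranging over sentences. Let $(T_0,P_0)^*:=\big((\emptyset,\emptyset),(\emptyset,P_0^{*-})\big)$, $(T_{\xi+1},P_{\xi+1})^*:=\Gamma^*\big((T_\xi,P_\xi)^*\big)$, and at limits $\lambda$ let $(T_\lambda,P_\lambda)^*:=\bigcup_{\xi<\lambda}(T_\xi,P_\xi)^*$ (componentwise). **Theorem.** The operator $\Gamma^*$ has a least fixed point $(T_\infty,P_\infty)^*$; the sequence $(T_\alpha,P_\alpha)^*$ is equal to it from some ordinal on; and $(\mathbb N,T_\infty,P_\infty)^*$ is a model of $\mathrm{TP}^+$. -/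

import Mathlib

namespace TPPlus

/-! ### The language `L`: arithmetic, finitely many function symbols for syntactic operations
and for characteristic functions, and the predicates `T` and `P`. -/

/-- Unary function symbols: successor; the operations forming (codes of) the literals
`T t`, `¬T t`, `P t`, `¬P t`; negation of formulas; the code of the numeral of a number; and the
characteristic functions of variables, terms, formulas, closed terms and sentences. -/
inductive F1 : Type
  | succ | trD | ntrD | paD | npaD | ng | num | var | tm | fml | clTm | sent
  deriving DecidableEq

/-- Binary function symbols: addition; multiplication; pairing; the operations forming (codes of)
`s = t`, `s ≠ t`, `φ ∧ ψ`, `φ ∨ ψ`, `∀ v φ`, `∃ v φ`; and the characteristic function of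
"`z` is not a variable that occurs free in the expression `x`". -/
inductive F2 : Type
  | add | mul | pair | eqD | neD | andD | orD | allD | exD | nfree
  deriving DecidableEq

/-- Terms. The variables are `v_0, v_1, …`; `sub` is the ternary symbol for substitution. -/
inductive Term : Type
  | var (n : ℕ)
  | zero
  | ap1 (f : F1) (t : Term)
  | ap2 (f : F2) (t s : Term)
  | sub (x y z : Term)
  deriving DecidableEq

/-- Formulas in Tait style, built from literals; negation is defined below. -/
inductive Fml : Type
  | eq (t s : Term)
  | ne (t s : Term)
  | tr (t : Term)
  | ntr (t : Term)
  | pa (t : Term)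
  | npa (t : Term)
  | and (φ ψ : Fml)
  | or (φ ψ : Fml)
  | all (v : ℕ) (φ : Fml)
  | ex (v : ℕ) (φ : Fml)
  deriving DecidableEq

local infix:55 " ≐ " => Fml.eq

/-- Negation, by De Morgan dualities. -/
def Fml.neg : Fml → Fml
  | .eq t s => .ne t s
  | .ne t s => .eq t s
  | .tr t => .ntr t
  | .ntr t => .tr t
  | .pa t => .npa t
  | .npa t => .pa t
  | .and φ ψ => .or φ.neg ψ.neg
  | .or φ ψ => .and φ.neg ψ.neg
  | .all v φ => .ex v φ.neg
  | .ex v φ => .all v φ.neg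

/-- Variables of a term. -/
def Term.fv : Term → Finset ℕ
  | .var n => {n}
  | .zero => ∅
  | .ap1 _ t => t.fv
  | .ap2 _ t s => t.fv ∪ s.fv
  | .sub x y z => x.fv ∪ y.fv ∪ z.fv

/-- Free variables of a formula. -/
def Fml.fv : Fml → Finset ℕ
  | .eq t s => t.fv ∪ s.fv
  | .ne t s => t.fv ∪ s.fv
  | .tr t => t.fv
  | .ntr t => t.fv
  | .pa t => t.fv
  | .npa t => t.fv
  | .and φ ψ => φ.fv ∪ ψ.fv
  | .or φ ψ => φ.fv ∪ ψ.fv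
  | .all v φ => φ.fv.erase v
  | .ex v φ => φ.fv.erase v

def Term.Closed (t : Term) : Prop := t.fv = ∅

def Fml.IsSentence (φ : Fml) : Prop := φ.fv = ∅

/-- `s.subst k t` is `s[t/v_k]`. -/
def Term.subst : Term → ℕ → Term → Term
  | .var n, k, t => if n = k then t else .var n
  | .zero, _, _ => .zero
  | .ap1 f s, k, t => .ap1 f (s.subst k t)
  | .ap2 f s r, k, t => .ap2 f (s.subst k t) (r.subst k t)
  | .sub x y z, k, t => .sub (x.subst k t) (y.subst k t) (z.subst k t)

/-- `φ.subst k t` is `φ[t/v_k]`: every free occurrence of `v_k` is replaced by `t`. -/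
def Fml.subst : Fml → ℕ → Term → Fml
  | .eq s r, k, t => .eq (s.subst k t) (r.subst k t)
  | .ne s r, k, t => .ne (s.subst k t) (r.subst k t)
  | .tr s, k, t => .tr (s.subst k t)
  | .ntr s, k, t => .ntr (s.subst k t)
  | .pa s, k, t => .pa (s.subst k t)
  | .npa s, k, t => .npa (s.subst k t)
  | .and φ ψ, k, t => .and (φ.subst k t) (ψ.subst k t)
  | .or φ ψ, k, t => .or (φ.subst k t) (ψ.subst k t)
  | .all v φ, k, t => if v = k then .all v φ else .all v (φ.subst k t)
  | .ex v φ, k, t => if v = k then .ex v φ else .ex v (φ.subst k t)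

/-- `t` is free for `v_k` in `φ`: no variable of `t` is captured in `φ[t/v_k]`. -/
def Fml.FreeFor (k : ℕ) (t : Term) : Fml → Prop
  | .eq _ _ => True
  | .ne _ _ => True
  | .tr _ => True
  | .ntr _ => True
  | .pa _ => True
  | .npa _ => True
  | .and φ ψ => φ.FreeFor k t ∧ ψ.FreeFor k t
  | .or φ ψ => φ.FreeFor k t ∧ ψ.FreeFor k t
  | .all v φ => k ∉ φ.fv.erase v ∨ (v ∉ t.fv ∧ φ.FreeFor k t)
  | .ex v φ => k ∉ φ.fv.erase v ∨ (v ∉ t.fv ∧ φ.FreeFor k t)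

/-- Formulas of arithmetic, i.e. without `T` and `P`. -/
def Fml.Arith : Fml → Prop
  | .eq _ _ => True
  | .ne _ _ => True
  | .tr _ => False
  | .ntr _ => False
  | .pa _ => False
  | .npa _ => False
  | .and φ ψ => φ.Arith ∧ ψ.Arith
  | .or φ ψ => φ.Arith ∧ ψ.Arith
  | .all _ φ => φ.Arith
  | .ex _ φ => φ.Arith

def Term.S (t : Term) : Term := .ap1 .succ t

/-- The numeral of `n`. -/
def numeral : ℕ → Term
  | 0 => .zero
  | n + 1 => (numeral n).S

/-! ### Gödel numbering -/

def F1.idx : F1 → ℕ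
  | .succ => 0 | .trD => 1 | .ntrD => 2 | .paD => 3 | .npaD => 4 | .ng => 5
  | .num => 6 | .var => 7 | .tm => 8 | .fml => 9 | .clTm => 10 | .sent => 11

def F2.idx : F2 → ℕ
  | .add => 0 | .mul => 1 | .pair => 2 | .eqD => 3 | .neD => 4
  | .andD => 5 | .orD => 6 | .allD => 7 | .exD => 8 | .nfree => 9

def Term.code : Term → ℕ
  | .var n => Nat.pair 0 n
  | .zero => Nat.pair 1 0
  | .ap1 f t => Nat.pair 2 (Nat.pair f.idx t.code)
  | .ap2 f t s => Nat.pair 3 (Nat.pair f.idx (Nat.pair t.code s.code))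
  | .sub x y z => Nat.pair 4 (Nat.pair x.code (Nat.pair y.code z.code))

def Fml.code : Fml → ℕ
  | .eq t s => Nat.pair 5 (Nat.pair t.code s.code)
  | .ne t s => Nat.pair 6 (Nat.pair t.code s.code)
  | .tr t => Nat.pair 7 t.code
  | .ntr t => Nat.pair 8 t.code
  | .pa t => Nat.pair 9 t.code
  | .npa t => Nat.pair 10 t.code
  | .and φ ψ => Nat.pair 11 (Nat.pair φ.code ψ.code)
  | .or φ ψ => Nat.pair 12 (Nat.pair φ.code ψ.code)
  | .all v φ => Nat.pair 13 (Nat.pair (Term.var v).code φ.code)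
  | .ex v φ => Nat.pair 14 (Nat.pair (Term.var v).code φ.code)

/-! ### The standard interpretation of the function symbols and of terms -/

open Classical in
/-- The characteristic function of a property. -/
noncomputable def chi (p : Prop) : ℕ := if p then 1 else 0

open Classical in
/-- Code of a formula to code of its negation; `0` on other numbers. -/
noncomputable def ngN (n : ℕ) : ℕ :=
  if h : ∃ φ : Fml, φ.code = n then h.choose.neg.code else 0

/-- `v_k` occurs free in the term or formula with code `x`. -/
def FreeInCode (k x : ℕ) : Prop :=
  (∃ t : Term, t.code = x ∧ k ∈ t.fv) ∨ ∃ φ : Fml, φ.code = x ∧ k ∈ φ.fv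

open Classical in
/-- `subN #e #t #v_k = #(e[t/v_k])` for terms and formulas `e`; `0` on other arguments. -/
noncomputable def subN (x y z : ℕ) : ℕ :=
  if h : ∃ p : Term × Term × ℕ, p.1.code = x ∧ p.2.1.code = y ∧ (Term.var p.2.2).code = z then
    (h.choose.1.subst h.choose.2.2 h.choose.2.1).code
  else if h : ∃ p : Fml × Term × ℕ, p.1.code = x ∧ p.2.1.code = y ∧ (Term.var p.2.2).code = z then
    (h.choose.1.subst h.choose.2.2 h.choose.2.1).code
  else 0

noncomputable def F1.eval : F1 → ℕ → ℕ
  | .succ, n => n + 1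
  | .trD, n => Nat.pair 7 n
  | .ntrD, n => Nat.pair 8 n
  | .paD, n => Nat.pair 9 n
  | .npaD, n => Nat.pair 10 n
  | .ng, n => ngN n
  | .num, n => (numeral n).code
  | .var, n => chi (∃ k, (Term.var k).code = n)
  | .tm, n => chi (∃ t : Term, t.code = n)
  | .fml, n => chi (∃ φ : Fml, φ.code = n)
  | .clTm, n => chi (∃ t : Term, t.Closed ∧ t.code = n)
  | .sent, n => chi (∃ φ : Fml, φ.IsSentence ∧ φ.code = n)

noncomputable def F2.eval : F2 → ℕ → ℕ → ℕ
  | .add, m, n => m + n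
  | .mul, m, n => m * n
  | .pair, m, n => Nat.pair m n
  | .eqD, m, n => Nat.pair 5 (Nat.pair m n)
  | .neD, m, n => Nat.pair 6 (Nat.pair m n)
  | .andD, m, n => Nat.pair 11 (Nat.pair m n)
  | .orD, m, n => Nat.pair 12 (Nat.pair m n)
  | .allD, m, n => Nat.pair 13 (Nat.pair m n)
  | .exD, m, n => Nat.pair 14 (Nat.pair m n)
  | .nfree, m, n => chi (¬ ∃ k, (Term.var k).code = m ∧ FreeInCode k n)

/-- Value of a term in the standard model under the assignment `e`. -/
noncomputable def Term.val (e : ℕ → ℕ) : Term → ℕ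
  | .var n => e n
  | .zero => 0
  | .ap1 f t => f.eval (t.val e)
  | .ap2 f t s => f.eval (t.val e) (s.val e)
  | .sub x y z => subN (x.val e) (y.val e) (z.val e)

/-! ### Strong Kleene satisfaction over the standard model -/

/-- Interpretations `((T⁺, T⁻), (P⁺, P⁻))`, ordered componentwise by inclusion. -/
abbrev Interp : Type := (Set ℕ × Set ℕ) × (Set ℕ × Set ℕ)

/-- `(ℕ, T, P) ⊨ φ` in Strong Kleene logic, under the assignment `e`. -/
def Sat (X : Interp) : (ℕ → ℕ) → Fml → Prop
  | e, .eq t s => t.val e = s.val e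
  | e, .ne t s => t.val e ≠ s.val e
  | e, .tr t => t.val e ∈ X.1.1
  | e, .ntr t => t.val e ∈ X.1.2
  | e, .pa t => t.val e ∈ X.2.1
  | e, .npa t => t.val e ∈ X.2.2
  | e, .and φ ψ => Sat X e φ ∧ Sat X e ψ
  | e, .or φ ψ => Sat X e φ ∨ Sat X e ψ
  | e, .all v φ => ∀ n, Sat X (Function.update e v n) φ
  | e, .ex v φ => ∃ n, Sat X (Function.update e v n) φ

/-- Satisfaction of sentences. -/
def Holds (X : Interp) (φ : Fml) : Prop := Sat X (fun _ => 0) φ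

/-! ### The system `PA[SK]` -/

def Term.plus (a b : Term) : Term := .ap2 .add a b
def Term.times (a b : Term) : Term := .ap2 .mul a b
def pr (a b : Term) : Term := .ap2 .pair a b
/-- The term `⟨k, a⟩`. -/
def node (k : ℕ) (a : Term) : Term := pr (numeral k) a

def isVar (a : Term) : Fml := .ap1 .var a ≐ numeral 1
def isTm (a : Term) : Fml := .ap1 .tm a ≐ numeral 1
def isFml (a : Term) : Fml := .ap1 .fml a ≐ numeral 1
def ClTm (a : Term) : Fml := .ap1 .clTm a ≐ numeral 1
def Sent (a : Term) : Fml := .ap1 .sent a ≐ numeral 1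

/-- The initial sequents of `PA`: the axioms for `0, S, +, ·`, and the (primitive recursive)
defining equations of the further function symbols. -/
inductive PAInit : Finset Fml → Finset Fml → Prop
  | succ_ne_zero (a) : PAInit {Term.S a ≐ .zero} ∅
  | succ_inj (a b) : PAInit {Term.S a ≐ Term.S b} {a ≐ b}
  | add_zero (a) : PAInit ∅ {Term.plus a .zero ≐ a}
  | add_succ (a b) : PAInit ∅ {Term.plus a (Term.S b) ≐ Term.S (Term.plus a b)}
  | mul_zero (a) : PAInit ∅ {Term.times a .zero ≐ .zero}
  | mul_succ (a b) : PAInit ∅ {Term.times a (Term.S b) ≐ Term.plus (Term.times a b) a}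
  -- pairing: `⟨a, c⟩ = c² + a` if `a < c`, and `⟨c, a⟩ = c² + c + a` if `a ≤ c`
  | pair_lt (a b c) : PAInit {c ≐ Term.plus a (Term.S b)} {pr a c ≐ Term.plus (Term.times c c) a}
  | pair_ge (a b c) : PAInit {c ≐ Term.plus a b}
      {pr c a ≐ Term.plus (Term.plus (Term.times c c) c) a}
  -- formation of formulas
  | form1 (f k) (h : (f, k) ∈ [(F1.trD, 7), (F1.ntrD, 8), (F1.paD, 9), (F1.npaD, 10)]) (a) :
      PAInit ∅ {.ap1 f a ≐ node k a}
  | form2 (f k) (h : (f, k) ∈ [(F2.eqD, 5), (F2.neD, 6), (F2.andD, 11), (F2.orD, 12),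
        (F2.allD, 13), (F2.exD, 14)]) (a b) :
      PAInit ∅ {.ap2 f a b ≐ node k (pr a b)}
  -- codes of numerals
  | num_zero : PAInit ∅ {.ap1 .num .zero ≐ node 1 .zero}
  | num_succ (a) : PAInit ∅
      {.ap1 .num (Term.S a) ≐ node 2 (pr (numeral F1.succ.idx) (.ap1 .num a))}
  -- variables
  | var_var (a) : PAInit ∅ {.ap1 .var (node 0 a) ≐ numeral 1}
  | var_other (a b) : PAInit ∅ {.ap1 .var (pr (Term.S a) b) ≐ .zero}
  -- terms
  | tm_var (a) : PAInit ∅ {.ap1 .tm (node 0 a) ≐ numeral 1}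
  | tm_zero : PAInit ∅ {.ap1 .tm (node 1 .zero) ≐ numeral 1}
  | tm_zero' (a) : PAInit ∅ {.ap1 .tm (node 1 (Term.S a)) ≐ .zero}
  | tm_ap1 (f : F1) (a) : PAInit ∅ {.ap1 .tm (node 2 (pr (numeral f.idx) a)) ≐ .ap1 .tm a}
  | tm_ap1' (a b) : PAInit ∅ {.ap1 .tm (node 2 (pr (Term.plus (numeral 12) a) b)) ≐ .zero}
  | tm_ap2 (f : F2) (a b) : PAInit ∅ {.ap1 .tm (node 3 (pr (numeral f.idx) (pr a b))) ≐
      Term.times (.ap1 .tm a) (.ap1 .tm b)}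
  | tm_ap2' (a b) : PAInit ∅ {.ap1 .tm (node 3 (pr (Term.plus (numeral 10) a) b)) ≐ .zero}
  | tm_sub (a b c) : PAInit ∅ {.ap1 .tm (node 4 (pr a (pr b c))) ≐
      Term.times (.ap1 .tm a) (Term.times (.ap1 .tm b) (.ap1 .tm c))}
  | tm_other (a b) : PAInit ∅ {.ap1 .tm (pr (Term.plus (numeral 5) a) b) ≐ .zero}
  -- formulas
  | fml_atom2 (f) (h : f ∈ [F2.eqD, F2.neD]) (a b) :
      PAInit ∅ {.ap1 .fml (.ap2 f a b) ≐ Term.times (.ap1 .tm a) (.ap1 .tm b)}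
  | fml_atom1 (f) (h : f ∈ [F1.trD, F1.ntrD, F1.paD, F1.npaD]) (a) :
      PAInit ∅ {.ap1 .fml (.ap1 f a) ≐ .ap1 .tm a}
  | fml_conn (f) (h : f ∈ [F2.andD, F2.orD]) (a b) :
      PAInit ∅ {.ap1 .fml (.ap2 f a b) ≐ Term.times (.ap1 .fml a) (.ap1 .fml b)}
  | fml_quant (f) (h : f ∈ [F2.allD, F2.exD]) (a b) :
      PAInit ∅ {.ap1 .fml (.ap2 f a b) ≐ Term.times (.ap1 .var a) (.ap1 .fml b)}
  | fml_low (k) (h : k < 5) (a) : PAInit ∅ {.ap1 .fml (node k a) ≐ .zero}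
  | fml_other (a b) : PAInit ∅ {.ap1 .fml (pr (Term.plus (numeral 15) a) b) ≐ .zero}
  -- free variables
  | nfree_var (a) : PAInit ∅ {.ap2 .nfree (node 0 a) (node 0 a) ≐ .zero}
  | nfree_var' (a b) : PAInit ∅ {a ≐ b, .ap2 .nfree (node 0 a) (node 0 b) ≐ numeral 1}
  | nfree_zero (a) : PAInit ∅ {.ap2 .nfree a (node 1 .zero) ≐ numeral 1}
  | nfree_ap1 (f : F1) (a b) : PAInit {isTm b}
      {.ap2 .nfree a (node 2 (pr (numeral f.idx) b)) ≐ .ap2 .nfree a b}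
  | nfree_ap2 (f : F2) (a b c) : PAInit {isTm b, isTm c}
      {.ap2 .nfree a (node 3 (pr (numeral f.idx) (pr b c))) ≐
        Term.times (.ap2 .nfree a b) (.ap2 .nfree a c)}
  | nfree_sub (a b c d) : PAInit {isTm b, isTm c, isTm d}
      {.ap2 .nfree a (node 4 (pr b (pr c d))) ≐
        Term.times (.ap2 .nfree a b) (Term.times (.ap2 .nfree a c) (.ap2 .nfree a d))}
  | nfree_atom2 (f) (h : f ∈ [F2.eqD, F2.neD]) (a b c) : PAInit {isTm b, isTm c}
      {.ap2 .nfree a (.ap2 f b c) ≐ Term.times (.ap2 .nfree a b) (.ap2 .nfree a c)}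
  | nfree_atom1 (f) (h : f ∈ [F1.trD, F1.ntrD, F1.paD, F1.npaD]) (a b) : PAInit {isTm b}
      {.ap2 .nfree a (.ap1 f b) ≐ .ap2 .nfree a b}
  | nfree_conn (f) (h : f ∈ [F2.andD, F2.orD]) (a b c) : PAInit {isFml b, isFml c}
      {.ap2 .nfree a (.ap2 f b c) ≐ Term.times (.ap2 .nfree a b) (.ap2 .nfree a c)}
  | nfree_quant (f) (h : f ∈ [F2.allD, F2.exD]) (a b) : PAInit {isVar a, isFml b}
      {.ap2 .nfree a (.ap2 f a b) ≐ numeral 1}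
  | nfree_quant' (f) (h : f ∈ [F2.allD, F2.exD]) (a b c) : PAInit {isVar c, isFml b}
      {a ≐ c, .ap2 .nfree a (.ap2 f c b) ≐ .ap2 .nfree a b}
  | nfree_other (a b) : PAInit ∅ {isVar a, .ap2 .nfree a b ≐ numeral 1}
  | nfree_other' (a b) : PAInit ∅ {isTm b, isFml b, .ap2 .nfree a b ≐ numeral 1}
  -- closed terms and sentences
  | clTm_tm (a) : PAInit {ClTm a} {isTm a}
  | clTm_nfree (a b) : PAInit {ClTm a} {.ap2 .nfree b a ≐ numeral 1}
  | clTm_intro (a : Term) (v) (h : v ∉ a.fv) :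
      PAInit {isTm a, .all v (.ap2 .nfree (.var v) a ≐ numeral 1)} {ClTm a}
  | clTm_other (a) : PAInit ∅ {ClTm a, .ap1 .clTm a ≐ .zero}
  | sent_fml (a) : PAInit {Sent a} {isFml a}
  | sent_nfree (a b) : PAInit {Sent a} {.ap2 .nfree b a ≐ numeral 1}
  | sent_intro (a : Term) (v) (h : v ∉ a.fv) :
      PAInit {isFml a, .all v (.ap2 .nfree (.var v) a ≐ numeral 1)} {Sent a}
  | sent_other (a) : PAInit ∅ {Sent a, .ap1 .sent a ≐ .zero}
  -- negation
  | ng_atom2 (f g) (h : (f, g) ∈ [(F2.eqD, F2.neD), (F2.neD, F2.eqD)]) (a b) :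
      PAInit {isTm a, isTm b} {.ap1 .ng (.ap2 f a b) ≐ .ap2 g a b}
  | ng_atom1 (f g) (h : (f, g) ∈ [(F1.trD, F1.ntrD), (F1.ntrD, F1.trD), (F1.paD, F1.npaD),
        (F1.npaD, F1.paD)]) (a) :
      PAInit {isTm a} {.ap1 .ng (.ap1 f a) ≐ .ap1 g a}
  | ng_conn (f g) (h : (f, g) ∈ [(F2.andD, F2.orD), (F2.orD, F2.andD)]) (a b) :
      PAInit {isFml a, isFml b} {.ap1 .ng (.ap2 f a b) ≐ .ap2 g (.ap1 .ng a) (.ap1 .ng b)}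
  | ng_quant (f g) (h : (f, g) ∈ [(F2.allD, F2.exD), (F2.exD, F2.allD)]) (a b) :
      PAInit {isVar a, isFml b} {.ap1 .ng (.ap2 f a b) ≐ .ap2 g a (.ap1 .ng b)}
  | ng_other (a) : PAInit ∅ {isFml a, .ap1 .ng a ≐ .zero}
  -- substitution
  | sub_var (a b) : PAInit {isTm b} {.sub (node 0 a) b (node 0 a) ≐ b}
  | sub_var' (a b c) : PAInit {isTm b} {a ≐ c, .sub (node 0 a) b (node 0 c) ≐ node 0 a}
  | sub_zero (b c) : PAInit {isTm b, isVar c} {.sub (node 1 .zero) b c ≐ node 1 .zero}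
  | sub_ap1 (f : F1) (a b c) : PAInit {isTm a, isTm b, isVar c}
      {.sub (node 2 (pr (numeral f.idx) a)) b c ≐ node 2 (pr (numeral f.idx) (.sub a b c))}
  | sub_ap2 (f : F2) (a a' b c) : PAInit {isTm a, isTm a', isTm b, isVar c}
      {.sub (node 3 (pr (numeral f.idx) (pr a a'))) b c ≐
        node 3 (pr (numeral f.idx) (pr (.sub a b c) (.sub a' b c)))}
  | sub_sub (a a' a'' b c) : PAInit {isTm a, isTm a', isTm a'', isTm b, isVar c}
      {.sub (node 4 (pr a (pr a' a''))) b c ≐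
        node 4 (pr (.sub a b c) (pr (.sub a' b c) (.sub a'' b c)))}
  | sub_atom2 (f) (h : f ∈ [F2.eqD, F2.neD]) (a a' b c) :
      PAInit {isTm a, isTm a', isTm b, isVar c}
      {.sub (.ap2 f a a') b c ≐ .ap2 f (.sub a b c) (.sub a' b c)}
  | sub_atom1 (f) (h : f ∈ [F1.trD, F1.ntrD, F1.paD, F1.npaD]) (a b c) :
      PAInit {isTm a, isTm b, isVar c} {.sub (.ap1 f a) b c ≐ .ap1 f (.sub a b c)}
  | sub_conn (f) (h : f ∈ [F2.andD, F2.orD]) (a a' b c) :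
      PAInit {isFml a, isFml a', isTm b, isVar c}
      {.sub (.ap2 f a a') b c ≐ .ap2 f (.sub a b c) (.sub a' b c)}
  | sub_quant (f) (h : f ∈ [F2.allD, F2.exD]) (a b c) : PAInit {isFml a, isTm b, isVar c}
      {.sub (.ap2 f c a) b c ≐ .ap2 f c a}
  | sub_quant' (f) (h : f ∈ [F2.allD, F2.exD]) (a b c d) :
      PAInit {isFml a, isTm b, isVar c, isVar d}
      {c ≐ d, .sub (.ap2 f d a) b c ≐ .ap2 f d (.sub a b c)}
  | sub_other (a b c) : PAInit ∅ {isTm a, isFml a, .sub a b c ≐ .zero}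
  | sub_other' (a b c) : PAInit ∅ {isTm b, .sub a b c ≐ .zero}
  | sub_other'' (a b c) : PAInit ∅ {isVar c, .sub a b c ≐ .zero}

/-- `v_u` does not occur free in the sequent `Γ ⇒ Δ`. -/
def NotFreeIn (u : ℕ) (Γ Δ : Finset Fml) : Prop := ∀ φ ∈ Γ ∪ Δ, u ∉ φ.fv

/-- Derivability of sequents in `PA[SK]` expanded by the initial sequents `Ax`:
the two-sided calculus for Strong Kleene logic with identity, the initial sequents of `PA`,
and the induction rule for all formulas of `L`. -/
inductive Derivable (Ax : Finset Fml → Finset Fml → Prop) : Finset Fml → Finset Fml → Prop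
  | ax {Γ Δ} (h : Ax Γ Δ) : Derivable Ax Γ Δ
  | pa {Γ Δ} (h : PAInit Γ Δ) : Derivable Ax Γ Δ
  | init (φ) : Derivable Ax {φ} {φ}
  | lneg {Γ Δ} {φ : Fml} (h : Derivable Ax Γ (insert φ Δ)) : Derivable Ax (insert φ.neg Γ) Δ
  | cut {Γ Δ φ} (h₁ : Derivable Ax Γ (insert φ Δ)) (h₂ : Derivable Ax (insert φ Γ) Δ) :
      Derivable Ax Γ Δ
  | lw {Γ Δ φ} (h : Derivable Ax Γ Δ) : Derivable Ax (insert φ Γ) Δ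
  | rw {Γ Δ φ} (h : Derivable Ax Γ Δ) : Derivable Ax Γ (insert φ Δ)
  | lor {Γ Δ φ ψ} (h₁ : Derivable Ax (insert φ Γ) Δ) (h₂ : Derivable Ax (insert ψ Γ) Δ) :
      Derivable Ax (insert (.or φ ψ) Γ) Δ
  | ror {Γ Δ φ ψ} (h : Derivable Ax Γ (insert φ (insert ψ Δ))) :
      Derivable Ax Γ (insert (.or φ ψ) Δ)
  | land {Γ Δ φ ψ} (h : Derivable Ax (insert φ (insert ψ Γ)) Δ) :
      Derivable Ax (insert (.and φ ψ) Γ) Δ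
  | rand {Γ Δ φ ψ} (h₁ : Derivable Ax Γ (insert φ Δ)) (h₂ : Derivable Ax Γ (insert ψ Δ)) :
      Derivable Ax Γ (insert (.and φ ψ) Δ)
  | lex {Γ Δ} {φ : Fml} (x u : ℕ) (hf : φ.FreeFor x (.var u)) (hu : NotFreeIn u Γ Δ)
      (hu' : u ∉ (Fml.ex x φ).fv) (h : Derivable Ax (insert (φ.subst x (.var u)) Γ) Δ) :
      Derivable Ax (insert (.ex x φ) Γ) Δ
  | rex {Γ Δ} {φ : Fml} (x : ℕ) (t : Term) (hf : φ.FreeFor x t)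
      (h : Derivable Ax Γ (insert (φ.subst x t) Δ)) : Derivable Ax Γ (insert (.ex x φ) Δ)
  | lall {Γ Δ} {φ : Fml} (x : ℕ) (t : Term) (hf : φ.FreeFor x t)
      (h : Derivable Ax (insert (φ.subst x t) Γ) Δ) : Derivable Ax (insert (.all x φ) Γ) Δ
  | rall {Γ Δ} {φ : Fml} (x u : ℕ) (hf : φ.FreeFor x (.var u)) (hu : NotFreeIn u Γ Δ)
      (hu' : u ∉ (Fml.all x φ).fv) (h : Derivable Ax Γ (insert (φ.subst x (.var u)) Δ)) :
      Derivable Ax Γ (insert (.all x φ) Δ)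
  | ref {Γ Δ} (t : Term) : Derivable Ax Γ (insert (t ≐ t) Δ)
  | repl {Γ Δ} {φ : Fml} (x : ℕ) (s t : Term) (hs : φ.FreeFor x s) (ht : φ.FreeFor x t)
      (h : Derivable Ax Γ (insert (φ.subst x t) Δ)) :
      Derivable Ax Γ (insert (.ne s t) (insert (φ.subst x s) Δ))
  | ind {Γ Δ} {φ : Fml} (x u : ℕ) (t : Term) (hf : φ.FreeFor x (.var u)) (ht : φ.FreeFor x t)
      (hu : NotFreeIn u Γ Δ) (hu' : u ∉ (Fml.all x φ).fv)
      (h : Derivable Ax (insert (φ.subst x (.var u)) Γ)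
        (insert (φ.subst x (Term.S (.var u))) Δ)) :
      Derivable Ax (insert (φ.subst x .zero) Γ) (insert (φ.subst x t) Δ)

/-- Derivability in `PA[SK]`. -/
def PASK : Finset Fml → Finset Fml → Prop := Derivable (fun _ _ => False)

/-- `φ` and `ψ` are `PA[SK]`-equivalent. -/
def PASKEquiv (φ ψ : Fml) : Prop :=
  PASK {φ} {ψ} ∧ PASK {ψ} {φ} ∧ PASK {φ.neg} {ψ.neg} ∧ PASK {ψ.neg} {φ.neg}

/-- `φ` is a base paradoxical sentence: it is `PA[SK]`-equivalent to `¬T⌜φ⌝`. -/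
def BaseParadoxical (φ : Fml) : Prop :=
  φ.IsSentence ∧ PASKEquiv φ (.ntr (numeral φ.code))

/-! ### The arithmetical formulas for base paradoxicality and for evaluation of closed terms -/

/-- `B(v_0)` is an arithmetical formula that defines, in the standard model, the set of (codes of)
base paradoxical sentences. (`T` and `P` do not occur in `B`: their interpretation is irrelevant.) -/
def DefinesBase (B : Fml) : Prop :=
  B.Arith ∧ B.fv ⊆ {0} ∧
    ∀ e : ℕ → ℕ, Sat ⊥ e B ↔ ∃ φ : Fml, BaseParadoxical φ ∧ φ.code = e 0

/-- `V(v_0, v_1)` is an arithmetical formula that defines, in the standard model, the graph of the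
evaluation function for (codes of) closed terms. -/
def DefinesVal (V : Fml) : Prop :=
  V.Arith ∧ V.fv ⊆ {0, 1} ∧
    ∀ e : ℕ → ℕ, Sat ⊥ e V ↔ ∃ t : Term, t.Closed ∧ t.code = e 0 ∧ t.val e = e 1

/-- `B(a)`, written so that no variable is captured, for terms `a` not containing `v_0`. -/
def instB (B : Fml) (a : Term) : Fml := .ex 0 (.and (.var 0 ≐ a) B)

/-- `Π(a) := B(a) ∨ B(¬a)`, for terms `a` not containing `v_0`. -/
def Pi (B : Fml) (a : Term) : Fml := .or (instB B a) (instB B (.ap1 .ng a))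

/-- `val(a) = b`, for terms `a`, `b` containing neither `v_0` nor `v_1`. -/
def valIs (V : Fml) (a b : Term) : Fml :=
  .ex 0 (.ex 1 (.and (.and (.var 0 ≐ a) (.var 1 ≐ b)) V))

/-- `val(a) = val(b)`; the variables of `a`, `b` are among `v_2, …, v_7` (also below). -/
def valEq (V : Fml) (a b : Term) : Fml :=
  .ex 8 (.and (valIs V a (.var 8)) (valIs V b (.var 8)))

/-- `val(a) ≠ val(b)`. -/
def valNe (V : Fml) (a b : Term) : Fml :=
  .ex 8 (.ex 9 (.and (.and (valIs V a (.var 8)) (valIs V b (.var 9))) (.ne (.var 8) (.var 9))))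

/-- `T val(a)`, `¬T val(a)`, `P val(a)`, `¬P val(a)`, for `lit` one of `tr, ntr, pa, npa`. -/
def litVal (lit : Term → Fml) (V : Fml) (a : Term) : Fml :=
  .ex 8 (.and (valIs V a (.var 8)) (lit (.var 8)))

/-- `s(y)` for the matrix `s` of a quantification over `v`: (the code of) the result of
substituting the numeral of `y` for the variable `v` in `s`. -/
def at' (s v y : Term) : Term := .sub s (.ap1 .num y) v

/-! ### The theories `TP` and `TP⁺` -/

/-- `(Pa ∧ Pb) ∨ (Ta ∧ Pb) ∨ (Tb ∧ Pa)` for `lit = tr`, and the same with `¬T` for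
`T` if `lit = ntr`. -/
def connP (lit : Term → Fml) (a b : Term) : Fml :=
  .or (.and (.pa a) (.pa b)) (.or (.and (lit a) (.pa b)) (.and (lit b) (.pa a)))

/-- `∃y P s(y) ∧ ∀y (P s(y) ∨ T s(y))` for `lit = tr`, and the same with `¬T` for
`T` if `lit = ntr`. -/
def quantP (lit : Term → Fml) (s v : Term) : Fml :=
  .and (.ex 6 (.pa (at' s v (.var 6))))
    (.all 6 (.or (.pa (at' s v (.var 6))) (lit (at' s v (.var 6)))))

/-- `Iff2 C φ ψ Γ Δ`: the sequent `Γ ⇒ Δ` is `C, φ ⇒ ψ` or `C, ψ ⇒ φ`. -/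
def Iff2 (C : Finset Fml) (φ ψ : Fml) (Γ Δ : Finset Fml) : Prop :=
  (Γ = insert φ C ∧ Δ = {ψ}) ∨ (Γ = insert ψ C ∧ Δ = {φ})

local notation "𝐮" => Term.var 2
local notation "𝐯" => Term.var 3

/-- The truth, paradoxicality and interaction principles. Here `u` is `v_2` and `v` is `v_3`. -/
inductive TPInit (B V : Fml) : Finset Fml → Finset Fml → Prop
  -- truth principles
  | T1_eq {Γ Δ} (h : Iff2 {ClTm 𝐮, ClTm 𝐯} (valEq V 𝐮 𝐯) (.tr (.ap2 .eqD 𝐮 𝐯)) Γ Δ) :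
      TPInit B V Γ Δ
  | T1_ne {Γ Δ} (h : Iff2 {ClTm 𝐮, ClTm 𝐯} (valNe V 𝐮 𝐯) (.tr (.ap2 .neD 𝐮 𝐯)) Γ Δ) :
      TPInit B V Γ Δ
  | T2_pos {Γ Δ} (h : Iff2 {ClTm 𝐮} (litVal .pa V 𝐮) (.tr (.ap1 .paD 𝐮)) Γ Δ) : TPInit B V Γ Δ
  | T2_neg {Γ Δ} (h : Iff2 {ClTm 𝐮} (litVal .npa V 𝐮) (.tr (.ap1 .npaD 𝐮)) Γ Δ) : TPInit B V Γ Δ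
  | T3_pos {Γ Δ} (h : Iff2 {ClTm 𝐮} (litVal .tr V 𝐮) (.tr (.ap1 .trD 𝐮)) Γ Δ) : TPInit B V Γ Δ
  | T3_neg {Γ Δ} (h : Iff2 {Sent 𝐮} (.tr (.ap1 .ng 𝐮)) (.ntr 𝐮) Γ Δ) : TPInit B V Γ Δ
  | T4_and {Γ Δ} (h : Iff2 {Sent (.ap2 .andD 𝐮 𝐯)} (.and (.tr 𝐮) (.tr 𝐯))
      (.tr (.ap2 .andD 𝐮 𝐯)) Γ Δ) : TPInit B V Γ Δ
  | T4_or {Γ Δ} (h : Iff2 {Sent (.ap2 .orD 𝐮 𝐯)} (.or (.tr 𝐮) (.tr 𝐯))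
      (.tr (.ap2 .orD 𝐮 𝐯)) Γ Δ) : TPInit B V Γ Δ
  | T5_all {Γ Δ} (h : Iff2 {Sent (.ap2 .allD 𝐯 𝐮)} (.all 6 (.tr (at' 𝐮 𝐯 (.var 6))))
      (.tr (.ap2 .allD 𝐯 𝐮)) Γ Δ) : TPInit B V Γ Δ
  | T5_ex {Γ Δ} (h : Iff2 {Sent (.ap2 .exD 𝐯 𝐮)} (.ex 6 (.tr (at' 𝐮 𝐯 (.var 6))))
      (.tr (.ap2 .exD 𝐯 𝐮)) Γ Δ) : TPInit B V Γ Δ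
  -- paradoxicality principles
  | P1 : TPInit B V {Sent 𝐮, Pi B 𝐮} {.pa 𝐮}
  | P2_T {Γ Δ} (h : Iff2 {ClTm 𝐮} (.pa (.ap1 .ntrD 𝐮)) (.pa (.ap1 .trD 𝐮)) Γ Δ) : TPInit B V Γ Δ
  | P2_P {Γ Δ} (h : Iff2 {ClTm 𝐮} (.pa (.ap1 .npaD 𝐮)) (.pa (.ap1 .paD 𝐮)) Γ Δ) : TPInit B V Γ Δ
  | P3 {Γ Δ} (h : Iff2 {ClTm 𝐮} (.pa (.ap1 .trD 𝐮))
      (.or (litVal .pa V 𝐮) (Pi B (.ap1 .trD 𝐮))) Γ Δ) : TPInit B V Γ Δ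
  | P4 {Γ Δ} (h : Iff2 {Sent (.ap2 .andD 𝐮 𝐯)} (.pa (.ap2 .andD 𝐮 𝐯))
      (.or (connP .tr 𝐮 𝐯) (Pi B (.ap2 .andD 𝐮 𝐯))) Γ Δ) : TPInit B V Γ Δ
  | P5 {Γ Δ} (h : Iff2 {Sent (.ap2 .orD 𝐮 𝐯)} (.pa (.ap2 .orD 𝐮 𝐯))
      (.or (connP .ntr 𝐮 𝐯) (Pi B (.ap2 .orD 𝐮 𝐯))) Γ Δ) : TPInit B V Γ Δ
  | P6 {Γ Δ} (h : Iff2 {Sent (.ap2 .allD 𝐯 𝐮)} (.pa (.ap2 .allD 𝐯 𝐮))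
      (.or (quantP .tr 𝐮 𝐯) (Pi B (.ap2 .allD 𝐯 𝐮))) Γ Δ) : TPInit B V Γ Δ
  | P7 {Γ Δ} (h : Iff2 {Sent (.ap2 .exD 𝐯 𝐮)} (.pa (.ap2 .exD 𝐯 𝐮))
      (.or (quantP .ntr 𝐮 𝐯) (Pi B (.ap2 .exD 𝐯 𝐮))) Γ Δ) : TPInit B V Γ Δ
  -- interaction principle
  | I1 : TPInit B V {Sent 𝐮, .tr (.ap2 .orD 𝐮 (.ap1 .ng 𝐮))} {.npa 𝐮}

/-- The initial sequents of `TP⁺`: those of `TP` and `∅ ⇒ ¬PPt` for closed terms `t`. -/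
inductive TPPlusInit (B V : Fml) : Finset Fml → Finset Fml → Prop
  | tp {Γ Δ} (h : TPInit B V Γ Δ) : TPPlusInit B V Γ Δ
  | notPP : TPPlusInit B V {ClTm 𝐮} {.npa (.ap1 .paD 𝐮)}

/-- Derivability in `TP`. -/
def TP (B V : Fml) : Finset Fml → Finset Fml → Prop := Derivable (TPInit B V)

/-- Derivability in `TP⁺`. -/
def TPplus (B V : Fml) : Finset Fml → Finset Fml → Prop := Derivable (TPPlusInit B V)

/-- `(ℕ, T, P)` is a model of a system: it satisfies all derivable sequents (under all assignments
to the free variables). -/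
def Models (X : Interp) (S : Finset Fml → Finset Fml → Prop) : Prop :=
  ∀ Γ Δ, S Γ Δ → ∀ e : ℕ → ℕ, (∀ γ ∈ Γ, Sat X e γ) → ∃ δ ∈ Δ, Sat X e δ

/-! ### The modified jump -/

local notation "𝐱" => Term.var 2
local notation "𝐲" => Term.var 3
local notation "𝐳" => Term.var 4

/-- The disjuncts `𝒫_1(x), …, 𝒫_7(x)` of the formula `𝒫(x)`, where `x` is `v_2`. -/
def Pcl1 (B : Fml) : Fml := .and (Sent 𝐱) (Pi B 𝐱)
def Pcl2 (V : Fml) : Fml :=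
  .and (Sent 𝐱) (.ex 3 (.and (ClTm 𝐲) (.and (𝐱 ≐ .ap1 .trD 𝐲) (litVal .pa V 𝐲))))
def Pcl3 (V : Fml) : Fml :=
  .and (Sent 𝐱) (.ex 3 (.and (ClTm 𝐲) (.and (𝐱 ≐ .ap1 .ntrD 𝐲) (litVal .pa V 𝐲))))
def Pcl4 : Fml := .and (Sent 𝐱) (.ex 3 (.ex 4 (.and (𝐱 ≐ .ap2 .andD 𝐲 𝐳) (connP .tr 𝐲 𝐳))))
def Pcl5 : Fml := .and (Sent 𝐱) (.ex 3 (.ex 4 (.and (𝐱 ≐ .ap2 .orD 𝐲 𝐳) (connP .ntr 𝐲 𝐳))))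
def Pcl6 : Fml := .and (Sent 𝐱) (.ex 3 (.ex 4 (.and (𝐱 ≐ .ap2 .allD 𝐲 𝐳) (quantP .tr 𝐳 𝐲))))
def Pcl7 : Fml := .and (Sent 𝐱) (.ex 3 (.ex 4 (.and (𝐱 ≐ .ap2 .exD 𝐲 𝐳) (quantP .ntr 𝐳 𝐲))))

/-- The formula `𝒫(x)`. -/
def Pcl (B V : Fml) : Fml :=
  .or (Pcl1 B) (.or (Pcl2 V) (.or (Pcl3 V) (.or Pcl4 (.or Pcl5 (.or Pcl6 Pcl7)))))

/-- The set of all (codes of) sentences `P t`. -/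
def PSentences : Set ℕ := {n | ∃ t : Term, t.Closed ∧ (Fml.pa t).code = n}

/-- The modified jump `Γ*`: Kripke's jump for `T`, the closure conditions `𝒫(x)` for the extension
of `P`, and for the anti-extension of `P` the sentences with a truth value together with all
sentences `P t`. -/
def jump (B V : Fml) (X : Interp) : Interp :=
  (({n | ∃ φ : Fml, φ.IsSentence ∧ φ.code = n ∧ Holds X φ},
    {n | ∃ φ : Fml, φ.IsSentence ∧ φ.code = n ∧ Holds X φ.neg}),
   ({n | ∃ φ : Fml, φ.IsSentence ∧ φ.code = n ∧ Sat X (fun _ => n) (Pcl B V)},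
    {n | ∃ φ : Fml, φ.IsSentence ∧ φ.code = n ∧ Holds X (.or φ φ.neg)} ∪ PSentences))

/-- The transfinite sequence of interpretations: all sentences `P t` are in the anti-extension of
`P` at stage `0`, the jump is applied at successors, unions are taken at limits. -/
noncomputable def stage (B V : Fml) (α : Ordinal.{0}) : Interp :=
  Ordinal.limitRecOn (motive := fun _ => Interp) α ((∅, ∅), (∅, PSentences))
    (fun _ X => jump B V X) (fun l _ ih => ⨆ β : Set.Iio l, ih β.1 β.2)

end TPPlus

namespace TPPlus

/-! ### Gödel numbering -/

/-! Strong Kleene satisfaction is positive in the four sets of an interpretation, since negation is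
pushed to the literals and `¬T`, `¬P` have sets of their own. Hence the jump is monotone. Every
value of the jump contains the initial stage, because the sentences `P t` are added to the
anti-extension of `P` each time; so the stages increase, lie below every fixed point, and must
repeat, as the ordinals do not inject into the set of interpretations. A repetition yields the least
fixed point.

At a fixed point, membership of a sentence in one of the four sets is equivalent to the
corresponding clause of the jump, and this equivalence is what the truth, paradoxicality and
interaction principles say (`TPInit.valid`, `TPPlusInit.valid`). The logical rules are sound too,
with one proviso: L¬ needs extensions and anti-extensions to be disjoint (`Derivable.valid`).

The substance of the proof is therefore consistency of the stages. The invariant carried along them,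
`Sound`, says in addition that nothing in the extension of `P` is true or false. For the successor
step (`not_holds_of_mem_jump_pa`, `Sound.jump`), induction on the complexity of `φ` shows that a
sentence newly declared paradoxical has no truth value. The base case is the liar argument: if `φ`
is `PA[SK]`-equivalent to `¬T⌜φ⌝`, then by soundness `φ` holds exactly if its code is in the
anti-extension of `T`, which in turn requires `¬φ` to hold. The other closure conditions pass the
lack of a truth value from components to compounds.

What remains is the effect of the added sentences `P t`: they must stay out of the extension of `P`.
The only clause that could put them there is base paradoxicality of `P t` or `¬P t`, and that is
refuted by an interpretation in which everything is untrue while `P` is empty on both sides. -/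

theorem F1.idx_inj {f g : F1} : f.idx = g.idx ↔ f = g := by
  cases f <;> cases g <;> simp [F1.idx]

theorem F2.idx_inj {f g : F2} : f.idx = g.idx ↔ f = g := by
  cases f <;> cases g <;> simp [F2.idx]

theorem F1.idx_lt (f : F1) : f.idx < 12 := by cases f <;> simp [F1.idx]

theorem F2.idx_lt (f : F2) : f.idx < 10 := by cases f <;> simp [F2.idx]

@[simp] theorem Term.code_inj {t s : Term} : t.code = s.code ↔ t = s := by
  induction t generalizing s <;> cases s <;>
    simp_all [Term.code, Nat.pair_eq_pair, F1.idx_inj, F2.idx_inj]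

@[simp] theorem Fml.code_inj {φ ψ : Fml} : φ.code = ψ.code ↔ φ = ψ := by
  induction φ generalizing ψ <;> cases ψ <;>
    simp_all [Fml.code, Nat.pair_eq_pair]

@[simp] theorem Term.code_ne_fml (t : Term) (φ : Fml) : t.code ≠ φ.code := by
  cases t <;> cases φ <;> simp [Term.code, Fml.code, Nat.pair_eq_pair]

@[simp] theorem Fml.code_ne_term (t : Term) (φ : Fml) : φ.code ≠ t.code :=
  (Term.code_ne_fml t φ).symm

@[simp] theorem Fml.neg_neg (φ : Fml) : φ.neg.neg = φ := by
  induction φ <;> simp_all [Fml.neg]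

@[simp] theorem Fml.fv_neg (φ : Fml) : φ.neg.fv = φ.fv := by
  induction φ <;> simp_all [Fml.neg, Fml.fv]

/-- The operations on codes are defined by choosing an expression with the given code; injectivity
of the coding makes the choice irrelevant. -/
theorem ngN_code (φ : Fml) : ngN φ.code = φ.neg.code := by
  have h : ∃ ψ : Fml, ψ.code = φ.code := ⟨φ, rfl⟩
  have := h.choose_spec
  rw [ngN, dif_pos h, Fml.code_inj.1 this]

theorem ngN_of_not {n : ℕ} (h : ¬ ∃ φ : Fml, φ.code = n) : ngN n = 0 := dif_neg h

theorem freeInCode_term (k : ℕ) (t : Term) : FreeInCode k t.code ↔ k ∈ t.fv := by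
  simp [FreeInCode]

theorem freeInCode_fml (k : ℕ) (φ : Fml) : FreeInCode k φ.code ↔ k ∈ φ.fv := by
  simp [FreeInCode]

theorem subN_term (t s : Term) (k : ℕ) :
    subN t.code s.code (Term.var k).code = (t.subst k s).code := by
  have h : ∃ p : Term × Term × ℕ, p.1.code = t.code ∧ p.2.1.code = s.code ∧
      (Term.var p.2.2).code = (Term.var k).code := ⟨(t, s, k), rfl, rfl, rfl⟩
  obtain ⟨h1, h2, h3⟩ := h.choose_spec
  rw [Term.code_inj] at h1 h2 h3
  rw [subN, dif_pos h, h1, h2, Term.var.inj h3]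

theorem subN_fml (φ : Fml) (s : Term) (k : ℕ) :
    subN φ.code s.code (Term.var k).code = (φ.subst k s).code := by
  -- The term branch in the definition of `subN` is tried first; it is excluded here because no
  -- number codes both a term and a formula.
  have h' : ¬ ∃ p : Term × Term × ℕ, p.1.code = φ.code ∧ p.2.1.code = s.code ∧
      (Term.var p.2.2).code = (Term.var k).code := by simp
  have h : ∃ p : Fml × Term × ℕ, p.1.code = φ.code ∧ p.2.1.code = s.code ∧
      (Term.var p.2.2).code = (Term.var k).code := ⟨(φ, s, k), rfl, rfl, rfl⟩
  obtain ⟨h1, h2, h3⟩ := h.choose_spec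
  rw [Term.code_inj] at h2 h3
  rw [subN, dif_neg h', dif_pos h, Fml.code_inj.1 h1, h2, Term.var.inj h3]

theorem subN_eq_zero {x y z : ℕ}
    (h : ¬ (((∃ t : Term, t.code = x) ∨ ∃ φ : Fml, φ.code = x) ∧ (∃ t : Term, t.code = y) ∧
      ∃ k, (Term.var k).code = z)) : subN x y z = 0 := by
  rw [subN, dif_neg, dif_neg]
  · rintro ⟨p, h1, h2, h3⟩
    exact h ⟨.inr ⟨_, h1⟩, ⟨_, h2⟩, _, h3⟩
  · rintro ⟨p, h1, h2, h3⟩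
    exact h ⟨.inl ⟨_, h1⟩, ⟨_, h2⟩, _, h3⟩

@[simp] theorem chi_eq_one {p : Prop} : chi p = 1 ↔ p := by simp [chi]

@[simp] theorem chi_eq_zero {p : Prop} : chi p = 0 ↔ ¬ p := by simp [chi]

theorem chi_and (p q : Prop) : chi (p ∧ q) = chi p * chi q := by
  by_cases p <;> by_cases q <;> simp_all [chi]

/-! ### Substitution and coincidence -/

@[simp] theorem val_numeral (e : ℕ → ℕ) (n : ℕ) : (numeral n).val e = n := by
  induction n <;> simp_all [numeral, Term.val, Term.S, F1.eval]

@[simp] theorem fv_numeral (n : ℕ) : (numeral n).fv = ∅ := by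
  induction n <;> simp_all [numeral, Term.fv, Term.S]

theorem Term.val_congr {e e' : ℕ → ℕ} {t : Term} (h : ∀ k ∈ t.fv, e k = e' k) :
    t.val e = t.val e' := by
  induction t <;> simp_all [Term.val, Term.fv]

theorem Sat.congr {X : Interp} {φ : Fml} {e e' : ℕ → ℕ} (h : ∀ k ∈ φ.fv, e k = e' k) :
    Sat X e φ ↔ Sat X e' φ := by
  induction φ generalizing e e' with
  | eq t s | ne t s =>
    simp only [Fml.fv, Finset.mem_union] at h
    simp only [Sat, Term.val_congr fun k hk => h k (.inl hk),
      Term.val_congr fun k hk => h k (.inr hk)]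
  | tr t | ntr t | pa t | npa t => simp only [Sat, Term.val_congr h]
  | and φ ψ ih₁ ih₂ | or φ ψ ih₁ ih₂ =>
    simp only [Fml.fv, Finset.mem_union] at h
    simp only [Sat, ih₁ fun k hk => h k (.inl hk), ih₂ fun k hk => h k (.inr hk)]
  | all v φ ih =>
    refine forall_congr' fun n => ih fun k hk => ?_
    by_cases hkv : k = v
    · simp [hkv]
    · simp [hkv, h k (by simp [Fml.fv, hkv, hk])]
  | ex v φ ih =>
    refine exists_congr fun n => ih fun k hk => ?_
    by_cases hkv : k = v
    · simp [hkv]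
    · simp [hkv, h k (by simp [Fml.fv, hkv, hk])]

theorem Term.val_update {e : ℕ → ℕ} {t : Term} {k n : ℕ} (h : k ∉ t.fv) :
    t.val (Function.update e k n) = t.val e :=
  Term.val_congr fun _ hj => Function.update_of_ne (ne_of_mem_of_not_mem hj h) _ _

theorem Sat.update_iff {X : Interp} {φ : Fml} {e : ℕ → ℕ} {k n : ℕ} (h : k ∉ φ.fv) :
    Sat X (Function.update e k n) φ ↔ Sat X e φ :=
  Sat.congr fun _ hj => Function.update_of_ne (ne_of_mem_of_not_mem hj h) _ _

theorem Term.val_subst (e : ℕ → ℕ) (s : Term) (k : ℕ) (t : Term) :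
    (s.subst k t).val e = s.val (Function.update e k (t.val e)) := by
  induction s with
  | var n => by_cases h : n = k <;> simp [Term.subst, Term.val, h]
  | _ => simp_all [Term.subst, Term.val]

theorem Fml.subst_of_notMem {φ : Fml} {k : ℕ} (t : Term) (h : k ∉ φ.fv) : φ.subst k t = φ := by
  have ht : ∀ s : Term, k ∉ s.fv → s.subst k t = s := by
    intro s hs
    induction s <;> simp_all [Term.subst, Term.fv]
    rintro rfl; exact absurd rfl hs
  induction φ <;> simp_all [Fml.subst, Fml.fv] <;> grind

/-- Shared by both quantifiers. Either `k` is not free in the matrix, so that neither substitution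
nor update matters, or the bound variable does not occur in `t`, so that the value of `t` is
unaffected by the binder. -/
theorem Sat.subst_iff_of_binder {X : Interp} {φ : Fml} {k v : ℕ} {t : Term}
    (ih : ∀ e, φ.FreeFor k t →
      (Sat X e (φ.subst k t) ↔ Sat X (Function.update e k (t.val e)) φ))
    (hv : v ≠ k) (h : k ∉ φ.fv.erase v ∨ (v ∉ t.fv ∧ φ.FreeFor k t)) (e : ℕ → ℕ) (n : ℕ) :
    Sat X (Function.update e v n) (φ.subst k t) ↔
      Sat X (Function.update (Function.update e k (t.val e)) v n) φ := by
  rw [Function.update_comm hv.symm]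
  rcases h with h | ⟨h1, h2⟩
  · have hk : k ∉ φ.fv := fun hk => h (by simp [hk, hv.symm])
    rw [Fml.subst_of_notMem t hk, Sat.update_iff hk]
  · rw [ih _ h2, Term.val_update h1]

theorem Sat.subst_iff {X : Interp} {φ : Fml} {k : ℕ} {t : Term} (e : ℕ → ℕ)
    (h : φ.FreeFor k t) : Sat X e (φ.subst k t) ↔ Sat X (Function.update e k (t.val e)) φ := by
  induction φ generalizing e with
  | eq | ne | tr | ntr | pa | npa => simp only [Sat, Fml.subst, Term.val_subst]
  | and φ ψ ih₁ ih₂ | or φ ψ ih₁ ih₂ => simp only [Sat, Fml.subst, ih₁ e h.1, ih₂ e h.2]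
  | all v φ ih | ex v φ ih =>
    by_cases hv : v = k
    · subst hv
      simp [Fml.subst, Sat]
    · simp only [Fml.subst, if_neg hv, Sat, Sat.subst_iff_of_binder (fun e hf => ih e hf) hv h]

theorem Fml.freeFor_of_closed {t : Term} (ht : t.Closed) (k : ℕ) (φ : Fml) : φ.FreeFor k t := by
  induction φ <;> simp_all [Fml.FreeFor, Term.Closed]

theorem Sat.subst_numeral {X : Interp} {φ : Fml} (k n : ℕ) (e : ℕ → ℕ) :
    Sat X e (φ.subst k (numeral n)) ↔ Sat X (Function.update e k n) φ := by
  rw [Sat.subst_iff e (Fml.freeFor_of_closed (fv_numeral n) k φ), val_numeral]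

/-- Needed to know that numerical instances of a quantified sentence are sentences. -/
theorem Fml.fv_subst_numeral (φ : Fml) (k n : ℕ) :
    (φ.subst k (numeral n)).fv = φ.fv.erase k := by
  have ht : ∀ s : Term, (s.subst k (numeral n)).fv = s.fv.erase k := by
    intro s
    induction s with
    | var m =>
      by_cases h : m = k
      · simp [Term.subst, Term.fv, h]
      · simp [Term.subst, Term.fv, h, Ne.symm h]
    | _ => simp_all [Term.subst, Term.fv, Finset.erase_union_distrib]
  induction φ with
  | all v φ ih | ex v φ ih =>
    by_cases h : v = k
    · simp [Fml.subst, Fml.fv, h]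
    · simp [Fml.subst, Fml.fv, h, ih, Finset.erase_right_comm]
  | _ => simp_all [Fml.subst, Fml.fv, Finset.erase_union_distrib]

theorem Fml.neg_subst (φ : Fml) (k : ℕ) (t : Term) : (φ.subst k t).neg = φ.neg.subst k t := by
  induction φ with
  | all v φ ih | ex v φ ih => by_cases h : v = k <;> simp [Fml.subst, Fml.neg, h, ih]
  | _ => simp_all [Fml.subst, Fml.neg]

/-- The number of connectives and quantifiers of a formula. -/
def Fml.size : Fml → ℕ
  | .and φ ψ => φ.size + ψ.size + 1
  | .or φ ψ => φ.size + ψ.size + 1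
  | .all _ φ => φ.size + 1
  | .ex _ φ => φ.size + 1
  | _ => 0

/-- Instances of a quantified sentence are not subformulas of it, but they are smaller in this
measure; this is what permits an induction over sentences only. -/
theorem Fml.size_subst (φ : Fml) (k : ℕ) (t : Term) : (φ.subst k t).size = φ.size := by
  induction φ with
  | all v φ ih | ex v φ ih => by_cases h : v = k <;> simp [Fml.subst, Fml.size, h, ih]
  | _ => simp_all [Fml.subst, Fml.size]

/-! ### Properties of Strong Kleene satisfaction -/

/-- All literals, including `¬T t` and `¬P t`, assert membership in a set of the interpretation or
are arithmetical, and no connective reverses the direction. -/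
theorem Sat.mono {X Y : Interp} (h : X ≤ Y) {φ : Fml} {e : ℕ → ℕ} (hs : Sat X e φ) :
    Sat Y e φ := by
  induction φ generalizing e with
  | eq | ne => exact hs
  | tr => exact h.1.1 hs
  | ntr => exact h.1.2 hs
  | pa => exact h.2.1 hs
  | npa => exact h.2.2 hs
  | and _ _ ih₁ ih₂ => exact ⟨ih₁ hs.1, ih₂ hs.2⟩
  | or _ _ ih₁ ih₂ => exact hs.imp ih₁ ih₂
  | all _ _ ih => exact fun n => ih (hs n)
  | ex _ _ ih => exact hs.imp fun n => ih

/-- Transfers the defining properties of `B` and `V`, stated for the empty interpretation, to all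
interpretations. -/
theorem Sat.arith_iff {X Y : Interp} {φ : Fml} (h : φ.Arith) (e : ℕ → ℕ) :
    Sat X e φ ↔ Sat Y e φ := by
  induction φ generalizing e <;> simp_all [Fml.Arith, Sat]

/-- Extensions and anti-extensions are disjoint. -/
def Consistent (X : Interp) : Prop := Disjoint X.1.1 X.1.2 ∧ Disjoint X.2.1 X.2.2

/-- Disjointness excludes a clash at the literals, and De Morgan duality carries this upward.
Soundness of L¬ rests on it. -/
theorem Consistent.not_sat_neg {X : Interp} (h : Consistent X) {φ : Fml} {e : ℕ → ℕ}
    (hs : Sat X e φ) : ¬ Sat X e φ.neg := by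
  have h1 : ∀ n ∈ X.1.1, n ∉ X.1.2 := fun _ hn => Set.disjoint_left.1 h.1 hn
  have h2 : ∀ n ∈ X.2.1, n ∉ X.2.2 := fun _ hn => Set.disjoint_left.1 h.2 hn
  induction φ generalizing e <;> simp only [Sat, Fml.neg] at hs ⊢ <;> grind

/-! ### Soundness of the initial sequents of `PA` in the standard model -/

section Simp

variable (X : Interp) (e : ℕ → ℕ) (m n : ℕ) (s t : Term) (φ ψ : Fml)

/-! ### Values of terms and satisfaction clauses as rewrite rules -/

@[simp] theorem F1.eval_succ : F1.succ.eval n = n + 1 := rfl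
@[simp] theorem F1.eval_trD : F1.trD.eval n = Nat.pair 7 n := rfl
@[simp] theorem F1.eval_ntrD : F1.ntrD.eval n = Nat.pair 8 n := rfl
@[simp] theorem F1.eval_paD : F1.paD.eval n = Nat.pair 9 n := rfl
@[simp] theorem F1.eval_npaD : F1.npaD.eval n = Nat.pair 10 n := rfl
@[simp] theorem F1.eval_ng : F1.ng.eval n = ngN n := rfl
@[simp] theorem F1.eval_num : F1.num.eval n = (numeral n).code := rfl
@[simp] theorem F1.eval_var : F1.var.eval n = chi (∃ k, (Term.var k).code = n) := rfl
@[simp] theorem F1.eval_tm : F1.tm.eval n = chi (∃ t : Term, t.code = n) := rfl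
@[simp] theorem F1.eval_fml : F1.fml.eval n = chi (∃ φ : Fml, φ.code = n) := rfl
@[simp] theorem F1.eval_clTm :
    F1.clTm.eval n = chi (∃ t : Term, t.Closed ∧ t.code = n) := rfl
@[simp] theorem F1.eval_sent :
    F1.sent.eval n = chi (∃ φ : Fml, φ.IsSentence ∧ φ.code = n) := rfl

@[simp] theorem F2.eval_add : F2.add.eval m n = m + n := rfl
@[simp] theorem F2.eval_mul : F2.mul.eval m n = m * n := rfl
@[simp] theorem F2.eval_pair : F2.pair.eval m n = Nat.pair m n := rfl
@[simp] theorem F2.eval_eqD : F2.eqD.eval m n = Nat.pair 5 (Nat.pair m n) := rfl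
@[simp] theorem F2.eval_neD : F2.neD.eval m n = Nat.pair 6 (Nat.pair m n) := rfl
@[simp] theorem F2.eval_andD : F2.andD.eval m n = Nat.pair 11 (Nat.pair m n) := rfl
@[simp] theorem F2.eval_orD : F2.orD.eval m n = Nat.pair 12 (Nat.pair m n) := rfl
@[simp] theorem F2.eval_allD : F2.allD.eval m n = Nat.pair 13 (Nat.pair m n) := rfl
@[simp] theorem F2.eval_exD : F2.exD.eval m n = Nat.pair 14 (Nat.pair m n) := rfl

@[simp] theorem Term.val_var : (Term.var n).val e = e n := rfl
@[simp] theorem Term.val_zero : Term.zero.val e = 0 := rfl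
@[simp] theorem Term.val_ap1 (f : F1) : (Term.ap1 f t).val e = f.eval (t.val e) := rfl
@[simp] theorem Term.val_ap2 (f : F2) :
    (Term.ap2 f t s).val e = f.eval (t.val e) (s.val e) := rfl
@[simp] theorem Term.val_sub (x y z : Term) :
    (Term.sub x y z).val e = subN (x.val e) (y.val e) (z.val e) := rfl
@[simp] theorem Term.val_S : t.S.val e = t.val e + 1 := rfl
@[simp] theorem Term.val_plus : (t.plus s).val e = t.val e + s.val e := rfl
@[simp] theorem Term.val_times : (t.times s).val e = t.val e * s.val e := rfl
@[simp] theorem val_pr : (pr t s).val e = Nat.pair (t.val e) (s.val e) := rfl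
@[simp] theorem val_node : (node n t).val e = Nat.pair n (t.val e) := by simp [node]

@[simp] theorem sat_eq : Sat X e (.eq t s) ↔ t.val e = s.val e := Iff.rfl
@[simp] theorem sat_ne : Sat X e (.ne t s) ↔ t.val e ≠ s.val e := Iff.rfl
@[simp] theorem sat_tr : Sat X e (.tr t) ↔ t.val e ∈ X.1.1 := Iff.rfl
@[simp] theorem sat_ntr : Sat X e (.ntr t) ↔ t.val e ∈ X.1.2 := Iff.rfl
@[simp] theorem sat_pa : Sat X e (.pa t) ↔ t.val e ∈ X.2.1 := Iff.rfl
@[simp] theorem sat_npa : Sat X e (.npa t) ↔ t.val e ∈ X.2.2 := Iff.rfl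
@[simp] theorem sat_and : Sat X e (.and φ ψ) ↔ Sat X e φ ∧ Sat X e ψ := Iff.rfl
@[simp] theorem sat_or : Sat X e (.or φ ψ) ↔ Sat X e φ ∨ Sat X e ψ := Iff.rfl
@[simp] theorem sat_all :
    Sat X e (.all n φ) ↔ ∀ k, Sat X (Function.update e n k) φ := Iff.rfl
@[simp] theorem sat_ex :
    Sat X e (.ex n φ) ↔ ∃ k, Sat X (Function.update e n k) φ := Iff.rfl
@[simp] theorem sat_isVar : Sat X e (isVar t) ↔ ∃ k, (Term.var k).code = t.val e := by
  simp [isVar]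
@[simp] theorem sat_isTm : Sat X e (isTm t) ↔ ∃ s : Term, s.code = t.val e := by simp [isTm]
@[simp] theorem sat_isFml : Sat X e (isFml t) ↔ ∃ φ : Fml, φ.code = t.val e := by simp [isFml]
@[simp] theorem sat_ClTm :
    Sat X e (ClTm t) ↔ ∃ s : Term, s.Closed ∧ s.code = t.val e := by simp [ClTm]
@[simp] theorem sat_Sent :
    Sat X e (Sent t) ↔ ∃ φ : Fml, φ.IsSentence ∧ φ.code = t.val e := by simp [Sent]

end Simp

/-! ### The symbol for non-occurrence of free variables -/

theorem nfree_term (k : ℕ) (t : Term) :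
    F2.nfree.eval (Term.var k).code t.code = chi (k ∉ t.fv) := by
  simp [F2.eval, freeInCode_term]

theorem nfree_fml (k : ℕ) (φ : Fml) :
    F2.nfree.eval (Term.var k).code φ.code = chi (k ∉ φ.fv) := by
  simp [F2.eval, freeInCode_fml]

theorem nfree_of_not_var {m : ℕ} (h : ¬ ∃ k, (Term.var k).code = m) (n : ℕ) :
    F2.nfree.eval m n = 1 :=
  chi_eq_one.2 fun ⟨k, hk, _⟩ => h ⟨k, hk⟩

theorem nfree_of_not_expr {n : ℕ} (ht : ¬ ∃ t : Term, t.code = n) (hf : ¬ ∃ φ : Fml, φ.code = n)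
    (m : ℕ) : F2.nfree.eval m n = 1 := by
  refine chi_eq_one.2 ?_
  rintro ⟨k, -, ⟨t, h, -⟩ | ⟨φ, h, -⟩⟩
  exacts [ht ⟨t, h⟩, hf ⟨φ, h⟩]

theorem nfree_eq_one_of_closed {t : Term} (h : t.Closed) (m : ℕ) :
    F2.nfree.eval m t.code = 1 := by
  by_cases hm : ∃ k, (Term.var k).code = m
  · obtain ⟨k, rfl⟩ := hm
    rw [nfree_term, h]; simp
  · exact nfree_of_not_var hm _

theorem nfree_eq_one_of_sentence {φ : Fml} (h : φ.IsSentence) (m : ℕ) :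
    F2.nfree.eval m φ.code = 1 := by
  by_cases hm : ∃ k, (Term.var k).code = m
  · obtain ⟨k, rfl⟩ := hm
    rw [nfree_fml, h]; simp
  · exact nfree_of_not_var hm _

/-! ### Recognizing tagged pairs as codes -/

theorem fold_var (n : ℕ) : Nat.pair 0 n = (Term.var n).code := rfl
theorem fold_zero : Nat.pair 1 0 = Term.zero.code := rfl
theorem fold_ap1 (f : F1) (t : Term) :
    Nat.pair 2 (Nat.pair f.idx t.code) = (Term.ap1 f t).code := rfl
theorem fold_ap2 (f : F2) (t s : Term) :
    Nat.pair 3 (Nat.pair f.idx (Nat.pair t.code s.code)) = (Term.ap2 f t s).code := rfl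
theorem fold_sub (t s r : Term) :
    Nat.pair 4 (Nat.pair t.code (Nat.pair s.code r.code)) = (Term.sub t s r).code := rfl
theorem fold_eq (t s : Term) : Nat.pair 5 (Nat.pair t.code s.code) = (Fml.eq t s).code := rfl
theorem fold_ne (t s : Term) : Nat.pair 6 (Nat.pair t.code s.code) = (Fml.ne t s).code := rfl
theorem fold_tr (t : Term) : Nat.pair 7 t.code = (Fml.tr t).code := rfl
theorem fold_ntr (t : Term) : Nat.pair 8 t.code = (Fml.ntr t).code := rfl
theorem fold_pa (t : Term) : Nat.pair 9 t.code = (Fml.pa t).code := rfl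
theorem fold_npa (t : Term) : Nat.pair 10 t.code = (Fml.npa t).code := rfl
theorem fold_and (φ ψ : Fml) :
    Nat.pair 11 (Nat.pair φ.code ψ.code) = (Fml.and φ ψ).code := rfl
theorem fold_or (φ ψ : Fml) : Nat.pair 12 (Nat.pair φ.code ψ.code) = (Fml.or φ ψ).code := rfl
theorem fold_all (v : ℕ) (φ : Fml) :
    Nat.pair 13 (Nat.pair (Term.var v).code φ.code) = (Fml.all v φ).code := rfl
theorem fold_ex (v : ℕ) (φ : Fml) :
    Nat.pair 14 (Nat.pair (Term.var v).code φ.code) = (Fml.ex v φ).code := rfl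

/-- The tag of a pair determines the constructor, so being a code passes down to the components.
Together with `chi_and`, this lemma and its analogues below give the multiplicative recursion
equations for `tm` and `fml`. -/
theorem exists_term_code_ap1 (f : F1) (m : ℕ) :
    (∃ t : Term, t.code = Nat.pair 2 (Nat.pair f.idx m)) ↔ ∃ t : Term, t.code = m := by
  constructor
  · rintro ⟨t, h⟩
    cases t <;> simp [Term.code, Nat.pair_eq_pair] at h
    exact ⟨_, h.2⟩
  · rintro ⟨t, rfl⟩
    exact ⟨.ap1 f t, rfl⟩

theorem exists_term_code_ap2 (f : F2) (m n : ℕ) :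
    (∃ t : Term, t.code = Nat.pair 3 (Nat.pair f.idx (Nat.pair m n))) ↔
      (∃ t : Term, t.code = m) ∧ ∃ t : Term, t.code = n := by
  constructor
  · rintro ⟨t, h⟩
    cases t <;> simp [Term.code, Nat.pair_eq_pair] at h
    exact ⟨⟨_, h.2.1⟩, _, h.2.2⟩
  · rintro ⟨⟨t, rfl⟩, s, rfl⟩
    exact ⟨.ap2 f t s, rfl⟩

theorem exists_term_code_sub (m n k : ℕ) :
    (∃ t : Term, t.code = Nat.pair 4 (Nat.pair m (Nat.pair n k))) ↔
      (∃ t : Term, t.code = m) ∧ (∃ t : Term, t.code = n) ∧ ∃ t : Term, t.code = k := by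
  constructor
  · rintro ⟨t, h⟩
    cases t <;> simp [Term.code, Nat.pair_eq_pair] at h
    exact ⟨⟨_, h.1⟩, ⟨_, h.2.1⟩, _, h.2.2⟩
  · rintro ⟨⟨t, rfl⟩, ⟨s, rfl⟩, r, rfl⟩
    exact ⟨.sub t s r, rfl⟩

theorem exists_fml_code_atom1 {k : ℕ} (hk : k = 7 ∨ k = 8 ∨ k = 9 ∨ k = 10) (m : ℕ) :
    (∃ φ : Fml, φ.code = Nat.pair k m) ↔ ∃ t : Term, t.code = m := by
  constructor
  · rintro ⟨φ, h⟩
    cases φ <;> simp [Fml.code, Nat.pair_eq_pair] at h <;> first | exact ⟨_, h.2⟩ | omega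
  · rintro ⟨t, rfl⟩
    rcases hk with rfl | rfl | rfl | rfl
    exacts [⟨.tr t, rfl⟩, ⟨.ntr t, rfl⟩, ⟨.pa t, rfl⟩, ⟨.npa t, rfl⟩]

theorem exists_fml_code_atom2 {k : ℕ} (hk : k = 5 ∨ k = 6) (m n : ℕ) :
    (∃ φ : Fml, φ.code = Nat.pair k (Nat.pair m n)) ↔
      (∃ t : Term, t.code = m) ∧ ∃ t : Term, t.code = n := by
  constructor
  · rintro ⟨φ, h⟩
    cases φ <;> simp [Fml.code, Nat.pair_eq_pair] at h <;>
      first | exact ⟨⟨_, h.2.1⟩, _, h.2.2⟩ | omega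
  · rintro ⟨⟨t, rfl⟩, s, rfl⟩
    rcases hk with rfl | rfl
    exacts [⟨.eq t s, rfl⟩, ⟨.ne t s, rfl⟩]

theorem exists_fml_code_conn {k : ℕ} (hk : k = 11 ∨ k = 12) (m n : ℕ) :
    (∃ φ : Fml, φ.code = Nat.pair k (Nat.pair m n)) ↔
      (∃ φ : Fml, φ.code = m) ∧ ∃ φ : Fml, φ.code = n := by
  constructor
  · rintro ⟨φ, h⟩
    cases φ <;> simp [Fml.code, Nat.pair_eq_pair] at h <;>
      first | exact ⟨⟨_, h.2.1⟩, _, h.2.2⟩ | omega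
  · rintro ⟨⟨t, rfl⟩, s, rfl⟩
    rcases hk with rfl | rfl
    exacts [⟨.and t s, rfl⟩, ⟨.or t s, rfl⟩]

theorem exists_fml_code_quant {k : ℕ} (hk : k = 13 ∨ k = 14) (m n : ℕ) :
    (∃ φ : Fml, φ.code = Nat.pair k (Nat.pair m n)) ↔
      (∃ v, (Term.var v).code = m) ∧ ∃ φ : Fml, φ.code = n := by
  constructor
  · rintro ⟨φ, h⟩
    cases φ <;> simp [Fml.code, Nat.pair_eq_pair] at h <;>
      first | exact ⟨⟨_, h.2.1⟩, _, h.2.2⟩ | omega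
  · rintro ⟨⟨t, rfl⟩, s, rfl⟩
    rcases hk with rfl | rfl
    exacts [⟨.all t s, rfl⟩, ⟨.ex t s, rfl⟩]

/-- The sequent `Γ ⇒ Δ` is satisfied in `X` under all assignments. -/
def Valid (X : Interp) (Γ Δ : Finset Fml) : Prop :=
  ∀ e : ℕ → ℕ, (∀ γ ∈ Γ, Sat X e γ) → ∃ δ ∈ Δ, Sat X e δ

/-- The initial sequents contain neither `T` nor `P`, so they only state facts about the coding,
whatever `X` is. In most of the recursive cases the guards in the antecedent supply the expressions
coded by the arguments, and the equation is the matching clause of the syntactic definition. -/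
theorem PAInit.valid {Γ Δ : Finset Fml} (h : PAInit Γ Δ) (X : Interp) : Valid X Γ Δ := by
  intro e
  cases h with
  | succ_ne_zero | succ_inj | add_zero | mul_zero => simp
  | add_succ | mul_succ => simp; ring
  | pair_lt a b c =>
    simp only [Finset.mem_singleton, forall_eq, exists_eq_left, sat_eq, Term.val_plus, Term.val_S,
      val_pr, Term.val_times]
    intro h
    rw [Nat.pair, if_pos (by omega)]
  | pair_ge a b c =>
    simp only [Finset.mem_singleton, forall_eq, exists_eq_left, sat_eq, Term.val_plus,
      val_pr, Term.val_times]
    intro h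
    rw [Nat.pair, if_neg (by omega)]
  | form1 f k h a | form2 f k h a b =>
    simp only [List.mem_cons, Prod.mk.injEq, List.not_mem_nil, or_false] at h
    casesm* _ ∨ _ <;> obtain ⟨rfl, rfl⟩ := ‹_ ∧ _› <;> simp
  | num_zero | num_succ => simp [numeral, Term.code, Term.S]
  | var_var | tm_var => simp [fold_var]
  | tm_zero => simp [fold_zero]
  | var_other => simp [Term.code, Nat.pair_eq_pair]
  | tm_zero' a =>
    suffices ∀ t : Term, t.code ≠ Nat.pair 1 (a.val e + 1) by simpa
    intro t; cases t <;> simp [Term.code, Nat.pair_eq_pair]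
  | tm_ap1' a b =>
    suffices ∀ t : Term, t.code ≠ Nat.pair 2 (Nat.pair (12 + a.val e) (b.val e)) by simpa
    intro t; cases t <;> simp [Term.code, Nat.pair_eq_pair]
    -- There are 12 unary function symbols, so an index `12 + a` belongs to none of them.
    rename_i f _; have := f.idx_lt; omega
  | tm_ap2' a b =>
    suffices ∀ t : Term, t.code ≠ Nat.pair 3 (Nat.pair (10 + a.val e) (b.val e)) by simpa
    intro t; cases t <;> simp [Term.code, Nat.pair_eq_pair]
    rename_i f _ _; have := f.idx_lt; omega
  | tm_other a b =>
    suffices ∀ t : Term, t.code ≠ Nat.pair (5 + a.val e) (b.val e) by simpa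
    intro t; cases t <;> simp [Term.code, Nat.pair_eq_pair] <;> omega
  | fml_low k h a =>
    suffices ∀ φ : Fml, φ.code ≠ Nat.pair k (a.val e) by simpa
    intro t; cases t <;> simp [Fml.code, Nat.pair_eq_pair] <;> omega
  | fml_other a b =>
    suffices ∀ φ : Fml, φ.code ≠ Nat.pair (15 + a.val e) (b.val e) by simpa
    intro t; cases t <;> simp [Fml.code, Nat.pair_eq_pair] <;> omega
  | tm_ap1 | tm_ap2 | tm_sub =>
    simp [exists_term_code_ap1, exists_term_code_ap2, exists_term_code_sub, chi_and]
  | fml_atom2 f h a b | fml_atom1 f h a | fml_conn f h a b | fml_quant f h a b =>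
    simp only [List.mem_cons, List.not_mem_nil, or_false] at h
    casesm* _ ∨ _ <;> subst f <;>
      simp [exists_fml_code_atom1, exists_fml_code_atom2, exists_fml_code_conn,
        exists_fml_code_quant, chi_and]
  | nfree_var => simp [fold_var, nfree_term, Term.fv]
  | nfree_var' => simp [fold_var, nfree_term, Term.fv, em]
  | nfree_zero => simp [fold_zero, nfree_eq_one_of_closed (t := .zero) rfl]
  | nfree_ap1 f a b =>
    -- If `a` does not denote a variable, `nfree` takes the value 1 on both sides of the equation.
    by_cases ha : ∃ k, (Term.var k).code = a.val e
    · obtain ⟨k, hk⟩ := ha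
      simp [← hk]
      -- With the value turned into a variable, the hypothesis that it is a code can be eliminated
      -- by substitution. The same device recurs in the cases below.
      generalize b.val e = m
      rintro t rfl
      simp [fold_ap1, nfree_term, Term.fv]
    · simp [nfree_of_not_var ha]
  | nfree_ap2 f a b c =>
    by_cases ha : ∃ k, (Term.var k).code = a.val e
    · obtain ⟨k, hk⟩ := ha
      simp [← hk]
      generalize b.val e = m, c.val e = n
      rintro t rfl s rfl
      simp [fold_ap2, nfree_term, Term.fv, chi_and]
    · simp [nfree_of_not_var ha]
  | nfree_sub a b c d =>
    by_cases ha : ∃ k, (Term.var k).code = a.val e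
    · obtain ⟨k, hk⟩ := ha
      simp [← hk]
      generalize b.val e = m, c.val e = n, d.val e = l
      rintro t rfl s rfl r rfl
      simp [fold_sub, nfree_term, Term.fv, chi_and]
    · simp [nfree_of_not_var ha]
  | nfree_atom2 f h a b c =>
    by_cases ha : ∃ k, (Term.var k).code = a.val e
    · obtain ⟨k, hk⟩ := ha
      simp [← hk]
      generalize b.val e = m, c.val e = n
      rintro t rfl s rfl
      simp only [List.mem_cons, List.not_mem_nil, or_false] at h
      rcases h with rfl | rfl <;>
        simp [fold_eq, fold_ne, nfree_term, nfree_fml, Fml.fv, chi_and]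
    · simp [nfree_of_not_var ha]
  | nfree_atom1 f h a b =>
    by_cases ha : ∃ k, (Term.var k).code = a.val e
    · obtain ⟨k, hk⟩ := ha
      simp [← hk]
      generalize b.val e = m
      rintro t rfl
      simp only [List.mem_cons, List.not_mem_nil, or_false] at h
      rcases h with rfl | rfl | rfl | rfl <;>
        simp [fold_tr, fold_ntr, fold_pa, fold_npa, nfree_term, nfree_fml, Fml.fv]
    · simp [nfree_of_not_var ha]
  | nfree_conn f h a b c =>
    by_cases ha : ∃ k, (Term.var k).code = a.val e
    · obtain ⟨k, hk⟩ := ha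
      simp [← hk]
      generalize b.val e = m, c.val e = n
      rintro t rfl s rfl
      simp only [List.mem_cons, List.not_mem_nil, or_false] at h
      rcases h with rfl | rfl <;>
        simp [fold_and, fold_or, nfree_fml, Fml.fv, chi_and]
    · simp [nfree_of_not_var ha]
  | nfree_quant f h a b =>
    simp
    generalize a.val e = m, b.val e = n
    rintro k rfl φ rfl
    simp only [List.mem_cons, List.not_mem_nil, or_false] at h
    rcases h with rfl | rfl <;> simp [fold_all, fold_ex, nfree_fml, Fml.fv]
  | nfree_quant' f h a b c =>
    by_cases ha : ∃ k, (Term.var k).code = a.val e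
    · obtain ⟨k, hk⟩ := ha
      simp [← hk]
      generalize c.val e = m, b.val e = n
      rintro l rfl φ rfl
      by_cases hkl : k = l
      · simp [hkl]
      simp only [List.mem_cons, List.not_mem_nil, or_false] at h
      rcases h with rfl | rfl <;> simp [fold_all, fold_ex, nfree_fml, Fml.fv, hkl]
    · simp [nfree_of_not_var ha]
  | nfree_other a b =>
    by_cases ha : ∃ k, (Term.var k).code = a.val e
    · simp [ha]
    · simp [nfree_of_not_var ha]
  | nfree_other' a b =>
    by_cases h₁ : ∃ t : Term, t.code = b.val e
    · simp [h₁]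
    by_cases h₂ : ∃ φ : Fml, φ.code = b.val e
    · simp [h₂]
    simp [nfree_of_not_expr h₁ h₂]
  | clTm_tm a =>
    simp
    exact fun t _ ht => ⟨t, ht⟩
  | clTm_nfree a b =>
    simp
    generalize a.val e = m
    rintro t ht rfl
    exact nfree_eq_one_of_closed ht _
  | sent_fml a =>
    simp
    exact fun t _ ht => ⟨t, ht⟩
  | sent_nfree a b =>
    simp
    generalize a.val e = m
    rintro t ht rfl
    exact nfree_eq_one_of_sentence ht _
  | clTm_intro a v h =>
    simp [Term.val_update h]
    generalize a.val e = m
    rintro t rfl ht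
    refine ⟨t, Finset.eq_empty_of_forall_notMem fun k => ?_, rfl⟩
    -- The quantifier in the premise ranges over all numbers; only the codes of variables carry
    -- information.
    simpa [nfree_term] using ht (Term.var k).code
  | sent_intro a v h =>
    simp [Term.val_update h]
    generalize a.val e = m
    rintro t rfl ht
    refine ⟨t, Finset.eq_empty_of_forall_notMem fun k => ?_, rfl⟩
    simpa [nfree_fml] using ht (Term.var k).code
  | clTm_other a | sent_other a =>
    simp only [Finset.notMem_empty, false_imp_iff, implies_true, Finset.mem_insert,
      Finset.mem_singleton, exists_eq_or_imp, exists_eq_left, sat_eq, forall_const,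
      Term.val_ap1, F1.eval_clTm, F1.eval_sent, sat_ClTm, sat_Sent, Term.val_zero, chi_eq_zero]
    exact em _
  | ng_atom2 f g h a b =>
    simp
    generalize a.val e = m, b.val e = n
    rintro t rfl s rfl
    simp only [List.mem_cons, Prod.mk.injEq, List.not_mem_nil, or_false] at h
    rcases h with ⟨rfl, rfl⟩ | ⟨rfl, rfl⟩ <;> simp [fold_eq, fold_ne, ngN_code, Fml.neg]
  | ng_atom1 f g h a =>
    simp
    generalize a.val e = m
    rintro t rfl
    simp only [List.mem_cons, Prod.mk.injEq, List.not_mem_nil, or_false] at h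
    rcases h with ⟨rfl, rfl⟩ | ⟨rfl, rfl⟩ | ⟨rfl, rfl⟩ | ⟨rfl, rfl⟩ <;>
      simp [fold_tr, fold_ntr, fold_pa, fold_npa, ngN_code, Fml.neg]
  | ng_conn f g h a b =>
    simp
    generalize a.val e = m, b.val e = n
    rintro t rfl s rfl
    simp only [List.mem_cons, Prod.mk.injEq, List.not_mem_nil, or_false] at h
    rcases h with ⟨rfl, rfl⟩ | ⟨rfl, rfl⟩ <;> simp [fold_and, fold_or, ngN_code, Fml.neg]
  | ng_quant f g h a b =>
    simp
    generalize a.val e = m, b.val e = n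
    rintro t rfl s rfl
    simp only [List.mem_cons, Prod.mk.injEq, List.not_mem_nil, or_false] at h
    rcases h with ⟨rfl, rfl⟩ | ⟨rfl, rfl⟩ <;> simp [fold_all, fold_ex, ngN_code, Fml.neg]
  | ng_other a =>
    by_cases h : ∃ φ : Fml, φ.code = a.val e
    · simp [h]
    · simp [ngN_of_not h]
  | sub_var a b =>
    simp
    generalize b.val e = m
    rintro t rfl
    simp [fold_var, subN_term, Term.subst]
  | sub_var' a b c =>
    simp
    generalize b.val e = m
    rintro t rfl
    by_cases h : a.val e = c.val e <;> simp [fold_var, subN_term, Term.subst, h]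
  | sub_zero b c =>
    simp
    generalize b.val e = m, c.val e = n
    rintro t rfl k rfl
    simp [fold_zero, subN_term, Term.subst]
  | sub_ap1 f a b c =>
    simp
    generalize a.val e = l, b.val e = m, c.val e = n
    rintro s rfl t rfl k rfl
    simp [fold_ap1, subN_term, Term.subst]
  | sub_ap2 f a a' b c =>
    simp
    generalize a.val e = l, a'.val e = l', b.val e = m, c.val e = n
    rintro s rfl s' rfl t rfl k rfl
    simp [fold_ap2, subN_term, Term.subst]
  | sub_sub a a' a'' b c =>
    simp
    generalize a.val e = l, a'.val e = l', a''.val e = l'', b.val e = m, c.val e = n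
    rintro s rfl s' rfl s'' rfl t rfl k rfl
    simp [fold_sub, subN_term, Term.subst]
  | sub_atom2 f h a a' b c =>
    simp
    generalize a.val e = l, a'.val e = l', b.val e = m, c.val e = n
    rintro s rfl s' rfl t rfl k rfl
    simp only [List.mem_cons, List.not_mem_nil, or_false] at h
    rcases h with rfl | rfl <;> simp [fold_eq, fold_ne, subN_term, subN_fml, Fml.subst]
  | sub_atom1 f h a b c =>
    simp
    generalize a.val e = l, b.val e = m, c.val e = n
    rintro s rfl t rfl k rfl
    simp only [List.mem_cons, List.not_mem_nil, or_false] at h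
    rcases h with rfl | rfl | rfl | rfl <;>
      simp [fold_tr, fold_ntr, fold_pa, fold_npa, subN_term, subN_fml, Fml.subst]
  | sub_conn f h a a' b c =>
    simp
    generalize a.val e = l, a'.val e = l', b.val e = m, c.val e = n
    rintro s rfl s' rfl t rfl k rfl
    simp only [List.mem_cons, List.not_mem_nil, or_false] at h
    rcases h with rfl | rfl <;> simp [fold_and, fold_or, subN_fml, Fml.subst]
  | sub_quant f h a b c =>
    simp
    generalize a.val e = l, b.val e = m, c.val e = n
    rintro s rfl t rfl k rfl
    simp only [List.mem_cons, List.not_mem_nil, or_false] at h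
    rcases h with rfl | rfl <;> simp [fold_all, fold_ex, subN_fml, Fml.subst]
  | sub_quant' f h a b c d =>
    simp
    generalize a.val e = l, b.val e = m, c.val e = n, d.val e = n'
    rintro s rfl t rfl k rfl k' rfl
    by_cases hk : k = k'
    · simp [hk]
    simp only [List.mem_cons, List.not_mem_nil, or_false] at h
    rcases h with rfl | rfl <;>
      simp [fold_all, fold_ex, subN_fml, Fml.subst, Ne.symm hk]
  | sub_other a b c =>
    by_cases h₁ : ∃ t : Term, t.code = a.val e
    · simp [h₁]
    by_cases h₂ : ∃ φ : Fml, φ.code = a.val e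
    · simp [h₂]
    -- Outside codes of terms and formulas, `subN` has the default value 0.
    simp [subN_eq_zero fun h => h.1.elim h₁ h₂]
  | sub_other' a b c =>
    by_cases h₁ : ∃ t : Term, t.code = b.val e
    · simp [h₁]
    simp [subN_eq_zero fun h => h₁ h.2.1]
  | sub_other'' a b c =>
    by_cases h₁ : ∃ k, (Term.var k).code = c.val e
    · simp [h₁]
    simp [subN_eq_zero fun h => h₁ h.2.2]

/-! ### Soundness of the calculus -/

/-- Only the variables of the substituted term matter. In the induction rule this passes from the
eigenvariable `u` to its successor term. -/
theorem Fml.FreeFor.congr {s t : Term} (h : s.fv = t.fv) {k : ℕ} {φ : Fml}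
    (hf : φ.FreeFor k s) : φ.FreeFor k t := by
  induction φ with
  | and _ _ ih₁ ih₂ | or _ _ ih₁ ih₂ => exact ⟨ih₁ hf.1, ih₂ hf.2⟩
  | all v φ ih | ex v φ ih => exact hf.imp_right fun hf => ⟨h ▸ hf.1, ih hf.2⟩
  | _ => trivial

/-- The case `u = x` is allowed: then the outer update overrides the inner one. -/
theorem Sat.update_eigenvariable {X : Interp} {φ : Fml} {x u : ℕ} (hu : u ∉ φ.fv.erase x)
    (e : ℕ → ℕ) (m n : ℕ) : Sat X (Function.update (Function.update e u n) x m) φ ↔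
      Sat X (Function.update e x m) φ := by
  refine Sat.congr fun k hk => ?_
  by_cases hkx : k = x
  · simp [hkx]
  · have hku : k ≠ u := by
      rintro rfl
      exact hu (by simp [hkx, hk])
    simp [hkx, hku]

theorem Sat.subst_eigenvariable {X : Interp} {φ : Fml} {x u : ℕ} (hf : φ.FreeFor x (.var u))
    (hu : u ∉ φ.fv.erase x) (e : ℕ → ℕ) (n : ℕ) :
    Sat X (Function.update e u n) (φ.subst x (.var u)) ↔ Sat X (Function.update e x n) φ := by
  rw [Sat.subst_iff _ hf, Sat.update_eigenvariable hu]
  simp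

/-- The side formulas keep their status when the value of the eigenvariable changes. If the
antecedent holds and the succedent fails at `e`, the premise, read at the changed assignment, must
therefore be made true by a formula of `Δ'`. -/
theorem Valid.of_eigenvariable {X : Interp} {Γ Δ Γ' Δ' : Finset Fml} {u : ℕ}
    (hu : NotFreeIn u Γ Δ) (h : Valid X (Γ' ∪ Γ) (Δ' ∪ Δ)) {e : ℕ → ℕ} {n : ℕ}
    (hΓ : ∀ γ ∈ Γ, Sat X e γ) (hΔ : ∀ δ ∈ Δ, ¬ Sat X e δ)
    (hΓ' : ∀ γ ∈ Γ', Sat X (Function.update e u n) γ) :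
    ∃ δ ∈ Δ', Sat X (Function.update e u n) δ := by
  obtain ⟨δ, hδ, hs⟩ := h (Function.update e u n) fun γ hγ => by
    rcases Finset.mem_union.1 hγ with hγ | hγ
    · exact hΓ' γ hγ
    · exact (Sat.update_iff (hu γ (Finset.mem_union_left _ hγ))).2 (hΓ γ hγ)
  rcases Finset.mem_union.1 hδ with hδ | hδ
  · exact ⟨δ, hδ, hs⟩
  · exact absurd ((Sat.update_iff (hu δ (Finset.mem_union_right _ hδ))).1 hs) (hΔ δ hδ)

/-- Consistency enters only in the case L¬; classical reasoning in the metatheory handles the other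
rules. Induction is sound for all formulas because the domain is `ℕ`. -/
theorem Derivable.valid {X : Interp} (hX : Consistent X) {Ax : Finset Fml → Finset Fml → Prop}
    (hAx : ∀ Γ Δ, Ax Γ Δ → Valid X Γ Δ) {Γ Δ : Finset Fml} (h : Derivable Ax Γ Δ) :
    Valid X Γ Δ := by
  induction h with
  | ax h => exact hAx _ _ h
  | pa h => exact h.valid X
  | init φ => exact fun e h => ⟨φ, by simp, h φ (by simp)⟩
  | lneg h ih =>
    intro e hΓ
    rw [Finset.forall_mem_insert] at hΓ
    obtain ⟨δ, hδ, hs⟩ := ih e hΓ.2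
    rcases Finset.mem_insert.1 hδ with rfl | hδ
    · exact absurd hΓ.1 (hX.not_sat_neg hs)
    · exact ⟨δ, hδ, hs⟩
  | lex x u hf hu hu' h ih =>
    rename_i Γ Δ φ
    intro e hΓ
    rw [Finset.forall_mem_insert] at hΓ
    by_contra! hΔ
    obtain ⟨⟨n, hn⟩, hΓ⟩ := hΓ
    have := Valid.of_eigenvariable (Γ' := {φ.subst x (.var u)}) (Δ' := ∅) hu
      (by rwa [Finset.empty_union, ← Finset.insert_eq]) hΓ hΔ (n := n)
      (by simpa using (Sat.subst_eigenvariable hf hu' e n).2 hn)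
    simp at this
  | rall x u hf hu hu' h ih =>
    rename_i Γ Δ φ
    intro e hΓ
    by_contra! hΔ
    rw [Finset.forall_mem_insert] at hΔ
    refine hΔ.1 fun n => ?_
    have := Valid.of_eigenvariable (Γ' := ∅) (Δ' := {φ.subst x (.var u)}) hu
      (by rwa [Finset.empty_union, ← Finset.insert_eq]) hΓ hΔ.2 (n := n) (by simp)
    simpa [Sat.subst_eigenvariable hf hu'] using this
  | ind x u t hf ht hu hu' h ih =>
    rename_i Γ Δ φ
    intro e hΓ
    by_contra! hΔ
    rw [Finset.forall_mem_insert] at hΔ hΓ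
    refine hΔ.1 ((Sat.subst_iff e ht).2 ?_)
    -- The value of `t` is a standard number, so ordinary induction reaches it, one application of
    -- the premise per step.
    generalize t.val e = m
    induction m with
    | zero => exact (Sat.subst_iff e (Fml.freeFor_of_closed (t := .zero) rfl x φ)).1 hΓ.1
    | succ n ihn =>
      have := Valid.of_eigenvariable (Γ' := {φ.subst x (.var u)})
        (Δ' := {φ.subst x (Term.S (.var u))}) hu
        (by rwa [← Finset.insert_eq, ← Finset.insert_eq]) hΓ.2 hΔ.2 (n := n)
        (by simpa using (Sat.subst_eigenvariable hf hu' e n).2 ihn)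
      have hS : φ.FreeFor x (Term.S (.var u)) :=
        Fml.FreeFor.congr (s := .var u) (t := Term.S (.var u)) rfl hf
      simpa [Sat.subst_iff _ hS, Sat.update_eigenvariable hu'] using this
  | cut h₁ h₂ ih₁ ih₂ =>
    intro e hΓ
    obtain ⟨δ, hδ, hs⟩ := ih₁ e hΓ
    rcases Finset.mem_insert.1 hδ with rfl | hδ
    · exact ih₂ e (Finset.forall_mem_insert _ _ _ |>.2 ⟨hs, hΓ⟩)
    · exact ⟨δ, hδ, hs⟩
  | rex x t hf h ih =>
    intro e hΓ
    have := ih e hΓ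
    simp only [Finset.exists_mem_insert, Sat.subst_iff _ hf, sat_ex] at this ⊢
    exact this.imp_left fun h => ⟨_, h⟩
  | lall x t hf h ih =>
    intro e hΓ
    simp only [Finset.forall_mem_insert, sat_all] at hΓ
    exact ih e (Finset.forall_mem_insert _ _ _ |>.2 ⟨(Sat.subst_iff _ hf).2 (hΓ.1 _), hΓ.2⟩)
  | repl x s t hs ht h ih =>
    intro e hΓ
    have := ih e hΓ
    simp only [Finset.exists_mem_insert, Sat.subst_iff _ hs, Sat.subst_iff _ ht, sat_ne]
      at this ⊢
    by_cases hst : s.val e = t.val e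
    · rw [hst]; exact .inr this
    · exact .inl hst
  | ref t => exact fun e _ => ⟨_, Finset.mem_insert_self _ _, rfl⟩
  | lw h ih => exact fun e hΓ => ih e fun γ hγ => hΓ γ (Finset.mem_insert_of_mem hγ)
  | rw h ih => exact fun e hΓ => (ih e hΓ).imp fun δ hδ => ⟨Finset.mem_insert_of_mem hδ.1, hδ.2⟩
  | lor h₁ h₂ ih₁ ih₂ =>
    intro e
    have h₁ := ih₁ e
    have h₂ := ih₂ e
    simp only [Finset.forall_mem_insert, sat_or] at h₁ h₂ ⊢
    tauto
  | land h ih =>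
    intro e
    have := ih e
    simp only [Finset.forall_mem_insert, sat_and] at this ⊢
    tauto
  | ror h ih =>
    intro e
    have := ih e
    simp only [Finset.exists_mem_insert, sat_or] at this ⊢
    tauto
  | rand h₁ h₂ ih₁ ih₂ =>
    intro e
    have h₁ := ih₁ e
    have h₂ := ih₂ e
    simp only [Finset.exists_mem_insert, sat_and] at h₁ h₂ ⊢
    tauto

/-! ### Base paradoxical sentences -/

theorem PASKEquiv.holds_iff {φ ψ : Fml} (h : PASKEquiv φ ψ) {X : Interp} (hX : Consistent X) :
    (Holds X φ ↔ Holds X ψ) ∧ (Holds X φ.neg ↔ Holds X ψ.neg) := by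
  have key : ∀ {φ ψ : Fml}, PASK {φ} {ψ} → Holds X φ → Holds X ψ := fun h hs => by
    simpa [Holds] using h.valid hX (fun _ _ h => h.elim) (fun _ => 0) (by simpa [Holds] using hs)
  exact ⟨⟨key h.1, key h.2.1⟩, key h.2.2.1, key h.2.2.2⟩

/-- Soundness of `PA[SK]`, applied to the four derivable sequents. The second equivalence uses that
the dual of `¬T⌜φ⌝` is `T⌜φ⌝`. -/
theorem BaseParadoxical.holds_iff {φ : Fml} (h : BaseParadoxical φ) {X : Interp}
    (hX : Consistent X) :
    (Holds X φ ↔ φ.code ∈ X.1.2) ∧ (Holds X φ.neg ↔ φ.code ∈ X.1.1) := by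
  have := h.2.holds_iff hX
  simpa [Holds, Fml.neg] using this

/-- The countermodel for the next two lemmas: here `¬T⌜φ⌝` holds for every `φ`, so every base
paradoxical sentence would hold, whereas `P t` and `¬P t` do not. -/
theorem consistent_false_everywhere : Consistent ((∅, Set.univ), (∅, ∅)) := by
  simp [Consistent]

theorem not_baseParadoxical_pa (t : Term) : ¬ BaseParadoxical (.pa t) := fun h => by
  simpa [Holds] using (h.holds_iff consistent_false_everywhere).1

theorem not_baseParadoxical_npa (t : Term) : ¬ BaseParadoxical (.npa t) := fun h => by
  simpa [Holds] using (h.holds_iff consistent_false_everywhere).1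

/-! ### The arithmetical formulas in the standard model -/

theorem sat_instB {B : Fml} (hB : DefinesBase B) {a : Term} (ha : 0 ∉ a.fv) (X : Interp)
    (e : ℕ → ℕ) : Sat X e (instB B a) ↔ ∃ φ : Fml, BaseParadoxical φ ∧ φ.code = a.val e := by
  simp [instB, Term.val_update ha, Sat.arith_iff (X := X) (Y := ⊥) hB.1, hB.2.2]

theorem sat_Pi {B : Fml} (hB : DefinesBase B) {a : Term} (ha : 0 ∉ a.fv) {X : Interp}
    {e : ℕ → ℕ} {φ : Fml} (hφ : a.val e = φ.code) :
    Sat X e (Pi B a) ↔ BaseParadoxical φ ∨ BaseParadoxical φ.neg := by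
  simp [Pi, sat_instB hB, ha, Term.fv, hφ, ngN_code]

/-- The value of a closed term. -/
noncomputable abbrev Term.value (t : Term) : ℕ := t.val fun _ => 0

theorem Term.Closed.val_eq {t : Term} (h : t.Closed) (e : ℕ → ℕ) : t.val e = t.value :=
  Term.val_congr fun k hk => by rw [h] at hk; simp at hk

/-- A code determines its closed term, and the value of a closed term does not depend on the
assignment; hence the existential quantifier over terms in `DefinesVal` has at most one witness. -/
theorem sat_valIs {V : Fml} (hV : DefinesVal V) {a b : Term} (ha : 0 ∉ a.fv ∧ 1 ∉ a.fv)
    (hb : 0 ∉ b.fv ∧ 1 ∉ b.fv) {X : Interp} {e : ℕ → ℕ} {t : Term} (ht : t.Closed)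
    (hta : t.code = a.val e) : Sat X e (valIs V a b) ↔ b.val e = t.value := by
  have key : ∀ e', Sat X e' V ↔ ∃ t : Term, t.Closed ∧ t.code = e' 0 ∧ t.value = e' 1 := by
    intro e'
    rw [Sat.arith_iff (Y := ⊥) hV.1, hV.2.2]
    exact exists_congr fun s => and_congr_right fun hs => by rw [hs.val_eq]
  simp [valIs, key, Term.val_update, ha, hb, ← hta]
  tauto

section Interpretation

variable {B V : Fml} {X : Interp} {e : ℕ → ℕ} {a b : Term} {t s : Term}

theorem sat_valEq (hV : DefinesVal V) (ha : 0 ∉ a.fv ∧ 1 ∉ a.fv ∧ 8 ∉ a.fv)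
    (hb : 0 ∉ b.fv ∧ 1 ∉ b.fv ∧ 8 ∉ b.fv) (ht : t.Closed) (hs : s.Closed)
    (hta : t.code = a.val e) (hsb : s.code = b.val e) :
    Sat X e (valEq V a b) ↔ t.value = s.value := by
  simp only [valEq, sat_ex, sat_and]
  have h₁ := fun n => sat_valIs (X := X) hV ⟨ha.1, ha.2.1⟩ (b := .var 8) (by simp [Term.fv]) ht
    (e := Function.update e 8 n) (by rw [hta, Term.val_update ha.2.2])
  have h₂ := fun n => sat_valIs (X := X) hV ⟨hb.1, hb.2.1⟩ (b := .var 8) (by simp [Term.fv]) hs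
    (e := Function.update e 8 n) (by rw [hsb, Term.val_update hb.2.2])
  simp [h₁, h₂]

theorem sat_valNe (hV : DefinesVal V) (ha : 0 ∉ a.fv ∧ 1 ∉ a.fv ∧ 8 ∉ a.fv ∧ 9 ∉ a.fv)
    (hb : 0 ∉ b.fv ∧ 1 ∉ b.fv ∧ 8 ∉ b.fv ∧ 9 ∉ b.fv) (ht : t.Closed) (hs : s.Closed)
    (hta : t.code = a.val e) (hsb : s.code = b.val e) :
    Sat X e (valNe V a b) ↔ t.value ≠ s.value := by
  simp only [valNe, sat_ex, sat_and]
  have h₁ := fun n m => sat_valIs (X := X) hV ⟨ha.1, ha.2.1⟩ (b := .var 8) (by simp [Term.fv]) ht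
    (e := Function.update (Function.update e 8 n) 9 m)
    (by rw [hta, Term.val_update ha.2.2.2, Term.val_update ha.2.2.1])
  have h₂ := fun n m => sat_valIs (X := X) hV ⟨hb.1, hb.2.1⟩ (b := .var 9) (by simp [Term.fv]) hs
    (e := Function.update (Function.update e 8 n) 9 m)
    (by rw [hsb, Term.val_update hb.2.2.2, Term.val_update hb.2.2.1])
  simp [h₁, h₂]

/-- Stated for an abstract literal with its set `A`, so that `T`, `P` and `¬P` are treated at once.
-/
theorem sat_litVal (hV : DefinesVal V) (ha : 0 ∉ a.fv ∧ 1 ∉ a.fv ∧ 8 ∉ a.fv) (ht : t.Closed)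
    (hta : t.code = a.val e) {lit : Term → Fml} {A : Set ℕ}
    (hlit : ∀ e : ℕ → ℕ, Sat X e (lit (.var 8)) ↔ e 8 ∈ A) :
    Sat X e (litVal lit V a) ↔ t.value ∈ A := by
  simp only [litVal, sat_ex, sat_and]
  have h₁ := fun n => sat_valIs (X := X) hV ⟨ha.1, ha.2.1⟩ (b := .var 8) (by simp [Term.fv]) ht
    (e := Function.update e 8 n) (by rw [hta, Term.val_update ha.2.2])
  simp [h₁, hlit]

theorem val_at' {φ : Fml} {k : ℕ} (ha : 6 ∉ a.fv) (hb : 6 ∉ b.fv) (hφ : a.val e = φ.code)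
    (hk : b.val e = (Term.var k).code) (n : ℕ) :
    (at' a b (.var 6)).val (Function.update e 6 n) = (φ.subst k (numeral n)).code := by
  simp [at', Term.val_update, ha, hb, hφ, hk, subN_fml]

/-- The closure condition of `P` for a conjunction or disjunction of the sentences with codes
`m` and `n`, relative to the set `A` of true, respectively false, sentences. -/
def ConnPara (A P : Set ℕ) (m n : ℕ) : Prop :=
  (m ∈ P ∧ n ∈ P) ∨ (m ∈ A ∧ n ∈ P) ∨ (n ∈ A ∧ m ∈ P)

/-- The closure condition of `P` for a quantification with the instances `c 0, c 1, …`, relative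
to the set `A` of true, respectively false, sentences. -/
def QuantPara (A P : Set ℕ) (c : ℕ → ℕ) : Prop :=
  (∃ n, c n ∈ P) ∧ ∀ n, c n ∈ P ∨ c n ∈ A

theorem sat_connP {lit : Term → Fml} {A : Set ℕ}
    (hlit : ∀ (e : ℕ → ℕ) (t : Term), Sat X e (lit t) ↔ t.val e ∈ A) :
    Sat X e (connP lit a b) ↔ ConnPara A X.2.1 (a.val e) (b.val e) := by
  simp [connP, ConnPara, hlit]

theorem sat_quantP {lit : Term → Fml} {A : Set ℕ}
    (hlit : ∀ (e : ℕ → ℕ) (t : Term), Sat X e (lit t) ↔ t.val e ∈ A)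
    {φ : Fml} {k : ℕ} (ha : 6 ∉ a.fv) (hb : 6 ∉ b.fv) (hφ : a.val e = φ.code)
    (hk : b.val e = (Term.var k).code) :
    Sat X e (quantP lit a b) ↔
      QuantPara A X.2.1 fun n => (φ.subst k (numeral n)).code := by
  simp [quantP, QuantPara, hlit, val_at' ha hb hφ hk]

/-- The closure conditions of `P` for compound sentences and for sentences `T t`, `¬T t`. -/
def CompPara (X : Interp) : Fml → Prop
  | .tr t => t.value ∈ X.2.1
  | .ntr t => t.value ∈ X.2.1
  | .and φ ψ => ConnPara X.1.1 X.2.1 φ.code ψ.code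
  | .or φ ψ => ConnPara X.1.2 X.2.1 φ.code ψ.code
  | .all v φ => QuantPara X.1.1 X.2.1 fun n => (φ.subst v (numeral n)).code
  | .ex v φ => QuantPara X.1.2 X.2.1 fun n => (φ.subst v (numeral n)).code
  | _ => False

/-! ### The disjuncts of the closure formula for paradoxicality -/

theorem update_three (e : ℕ → ℕ) (m : ℕ) :
    Function.update e 3 m 2 = e 2 ∧ Function.update e 3 m 3 = m := by
  simp

theorem sat_Pcl2 (hV : DefinesVal V) {φ : Fml} (he : e 2 = φ.code) :
    Sat X e (Pcl2 V) ↔ φ.IsSentence ∧ ∃ t : Term, φ = .tr t ∧ CompPara X φ := by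
  have h : ∀ (t : Term) (n : ℕ), t.Closed → t.code = n →
      (Sat X (Function.update e 3 n) (litVal .pa V (.var 3)) ↔ t.value ∈ X.2.1) :=
    fun t n ht htn => sat_litVal hV (by simp [Term.fv]) ht (by simp [htn]) (by simp)
  simp only [Pcl2, sat_and, sat_Sent, Term.val_var, he, Fml.code_inj, exists_eq_right,
    and_congr_right_iff]
  intro hφ
  constructor
  · rintro ⟨n, hn⟩
    simp only [sat_and, sat_ClTm, sat_eq, Term.val_var, Term.val_ap1, update_three, he,
      F1.eval_trD] at hn
    obtain ⟨⟨t, ht, rfl⟩, h1, h2⟩ := hn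
    rw [fold_tr, Fml.code_inj] at h1
    subst h1
    exact ⟨t, rfl, (h t _ ht rfl).1 h2⟩
  · rintro ⟨t, rfl, ht⟩
    -- `hφ` serves as the closedness of `t`, since the free variables of `T t` are by definition
    -- those of `t`.
    exact ⟨t.code, (sat_ClTm _ _ _).2 ⟨t, hφ, by simp⟩, by simp [he, Fml.code], (h t _ hφ rfl).2 ht⟩

theorem sat_Pcl3 (hV : DefinesVal V) {φ : Fml} (he : e 2 = φ.code) :
    Sat X e (Pcl3 V) ↔ φ.IsSentence ∧ ∃ t : Term, φ = .ntr t ∧ CompPara X φ := by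
  have h : ∀ (t : Term) (n : ℕ), t.Closed → t.code = n →
      (Sat X (Function.update e 3 n) (litVal .pa V (.var 3)) ↔ t.value ∈ X.2.1) :=
    fun t n ht htn => sat_litVal hV (by simp [Term.fv]) ht (by simp [htn]) (by simp)
  simp only [Pcl3, sat_and, sat_Sent, Term.val_var, he, Fml.code_inj, exists_eq_right,
    and_congr_right_iff]
  intro hφ
  constructor
  · rintro ⟨n, hn⟩
    simp only [sat_and, sat_ClTm, sat_eq, Term.val_var, Term.val_ap1, update_three, he,
      F1.eval_ntrD] at hn
    obtain ⟨⟨t, ht, rfl⟩, h1, h2⟩ := hn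
    rw [fold_ntr, Fml.code_inj] at h1
    subst h1
    exact ⟨t, rfl, (h t _ ht rfl).1 h2⟩
  · rintro ⟨t, rfl, ht⟩
    exact ⟨t.code, (sat_ClTm _ _ _).2 ⟨t, hφ, by simp⟩, by simp [he, Fml.code], (h t _ hφ rfl).2 ht⟩

theorem update_three_four (e : ℕ → ℕ) (m n : ℕ) :
    Function.update (Function.update e 3 m) 4 n 2 = e 2 ∧
    Function.update (Function.update e 3 m) 4 n 3 = m ∧
    Function.update (Function.update e 3 m) 4 n 4 = n := by
  simp

theorem Fml.code_eq_and {φ : Fml} {m n : ℕ} : φ.code = Nat.pair 11 (Nat.pair m n) ↔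
    ∃ ψ χ : Fml, φ = .and ψ χ ∧ ψ.code = m ∧ χ.code = n := by
  cases φ <;> simp [Fml.code, Nat.pair_eq_pair]

theorem Fml.code_eq_or {φ : Fml} {m n : ℕ} : φ.code = Nat.pair 12 (Nat.pair m n) ↔
    ∃ ψ χ : Fml, φ = .or ψ χ ∧ ψ.code = m ∧ χ.code = n := by
  cases φ <;> simp [Fml.code, Nat.pair_eq_pair]

theorem Fml.code_eq_all {φ : Fml} {m n : ℕ} : φ.code = Nat.pair 13 (Nat.pair m n) ↔
    ∃ (v : ℕ) (ψ : Fml), φ = .all v ψ ∧ (Term.var v).code = m ∧ ψ.code = n := by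
  cases φ <;> simp [Fml.code, Nat.pair_eq_pair]

theorem Fml.code_eq_ex {φ : Fml} {m n : ℕ} : φ.code = Nat.pair 14 (Nat.pair m n) ↔
    ∃ (v : ℕ) (ψ : Fml), φ = .ex v ψ ∧ (Term.var v).code = m ∧ ψ.code = n := by
  cases φ <;> simp [Fml.code, Nat.pair_eq_pair]

theorem sat_Pcl4 {φ : Fml} (he : e 2 = φ.code) :
    Sat X e Pcl4 ↔ φ.IsSentence ∧ ∃ ψ χ : Fml, φ = .and ψ χ ∧ CompPara X φ := by
  simp only [Pcl4, sat_and, sat_ex, sat_Sent, sat_eq, Term.val_var, Term.val_ap2, F2.eval_andD,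
    update_three_four, sat_connP (A := X.1.1) (lit := .tr) fun _ _ => Iff.rfl, he, Fml.code_inj,
    exists_eq_right, and_congr_right_iff, Fml.code_eq_and]
  intro hφ
  constructor
  · rintro ⟨_, _, ⟨ψ, χ, rfl, rfl, rfl⟩, h⟩
    exact ⟨ψ, χ, rfl, h⟩
  · rintro ⟨ψ, χ, rfl, h⟩
    exact ⟨_, _, ⟨ψ, χ, rfl, rfl, rfl⟩, h⟩

theorem sat_Pcl5 {φ : Fml} (he : e 2 = φ.code) :
    Sat X e Pcl5 ↔ φ.IsSentence ∧ ∃ ψ χ : Fml, φ = .or ψ χ ∧ CompPara X φ := by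
  simp only [Pcl5, sat_and, sat_ex, sat_Sent, sat_eq, Term.val_var, Term.val_ap2, F2.eval_orD,
    update_three_four, sat_connP (A := X.1.2) (lit := .ntr) fun _ _ => Iff.rfl, he, Fml.code_inj,
    exists_eq_right, and_congr_right_iff, Fml.code_eq_or]
  intro hφ
  constructor
  · rintro ⟨_, _, ⟨ψ, χ, rfl, rfl, rfl⟩, h⟩
    exact ⟨ψ, χ, rfl, h⟩
  · rintro ⟨ψ, χ, rfl, h⟩
    exact ⟨_, _, ⟨ψ, χ, rfl, rfl, rfl⟩, h⟩

theorem sat_Pcl6 {φ : Fml} (he : e 2 = φ.code) :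
    Sat X e Pcl6 ↔ φ.IsSentence ∧ ∃ (v : ℕ) (ψ : Fml), φ = .all v ψ ∧ CompPara X φ := by
  have key : ∀ (v : ℕ) (ψ : Fml), Sat X (Function.update (Function.update e 3 (Term.var v).code) 4
      ψ.code) (quantP .tr (.var 4) (.var 3)) ↔ CompPara X (.all v ψ) := fun v ψ =>
    sat_quantP (A := X.1.1) (fun _ _ => Iff.rfl) (by simp [Term.fv]) (by simp [Term.fv])
      (by simp) (by simp)
  simp only [Pcl6, sat_and, sat_ex, sat_Sent, sat_eq, Term.val_var, Term.val_ap2, F2.eval_allD,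
    update_three_four, he, Fml.code_inj, exists_eq_right, and_congr_right_iff, Fml.code_eq_all]
  intro hφ
  constructor
  · rintro ⟨_, _, ⟨v, ψ, rfl, rfl, rfl⟩, h⟩
    exact ⟨v, ψ, rfl, (key v ψ).1 h⟩
  · rintro ⟨v, ψ, rfl, h⟩
    exact ⟨_, _, ⟨v, ψ, rfl, rfl, rfl⟩, (key v ψ).2 h⟩

theorem sat_Pcl7 {φ : Fml} (he : e 2 = φ.code) :
    Sat X e Pcl7 ↔ φ.IsSentence ∧ ∃ (v : ℕ) (ψ : Fml), φ = .ex v ψ ∧ CompPara X φ := by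
  have key : ∀ (v : ℕ) (ψ : Fml), Sat X (Function.update (Function.update e 3 (Term.var v).code) 4
      ψ.code) (quantP .ntr (.var 4) (.var 3)) ↔ CompPara X (.ex v ψ) := fun v ψ =>
    sat_quantP (A := X.1.2) (fun _ _ => Iff.rfl) (by simp [Term.fv]) (by simp [Term.fv])
      (by simp) (by simp)
  simp only [Pcl7, sat_and, sat_ex, sat_Sent, sat_eq, Term.val_var, Term.val_ap2, F2.eval_exD,
    update_three_four, he, Fml.code_inj, exists_eq_right, and_congr_right_iff, Fml.code_eq_ex]
  intro hφ
  constructor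
  · rintro ⟨_, _, ⟨v, ψ, rfl, rfl, rfl⟩, h⟩
    exact ⟨v, ψ, rfl, (key v ψ).1 h⟩
  · rintro ⟨v, ψ, rfl, h⟩
    exact ⟨_, _, ⟨v, ψ, rfl, rfl, rfl⟩, (key v ψ).2 h⟩

/-- The outermost form of `φ` selects at most one disjunct besides `Π`. For equations, inequations,
`P t` and `¬P t` none is selected, so these can become paradoxical only through `Π`. -/
theorem sat_Pcl (hB : DefinesBase B) (hV : DefinesVal V) {φ : Fml}
    (he : e 2 = φ.code) : Sat X e (Pcl B V) ↔ φ.IsSentence ∧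
      ((BaseParadoxical φ ∨ BaseParadoxical φ.neg) ∨ CompPara X φ) := by
  simp only [Pcl, Pcl1, sat_or, sat_and, sat_Sent, sat_Pi hB (a := .var 2) (by simp [Term.fv]) he,
    sat_Pcl2 hV he, sat_Pcl3 hV he, sat_Pcl4 he, sat_Pcl5 he, sat_Pcl6 he, sat_Pcl7 he,
    Term.val_var, he, Fml.code_inj, exists_eq_right, ← and_or_left, and_congr_right_iff]
  intro _
  refine or_congr_right ?_
  cases φ <;> simp [CompPara]

/-! ### The modified jump -/

theorem mem_jump_tr {φ : Fml} (hφ : φ.IsSentence) :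
    φ.code ∈ (jump B V X).1.1 ↔ Holds X φ := by
  simp [jump, hφ]

theorem mem_jump_ntr {φ : Fml} (hφ : φ.IsSentence) :
    φ.code ∈ (jump B V X).1.2 ↔ Holds X φ.neg := by
  simp [jump, hφ]

theorem mem_jump_pa (hB : DefinesBase B) (hV : DefinesVal V) {φ : Fml} (hφ : φ.IsSentence) :
    φ.code ∈ (jump B V X).2.1 ↔
      (BaseParadoxical φ ∨ BaseParadoxical φ.neg) ∨ CompPara X φ := by
  simp [jump, hφ, sat_Pcl hB hV (e := fun _ => φ.code) rfl]

theorem mem_jump_npa {φ : Fml} (hφ : φ.IsSentence) :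
    φ.code ∈ (jump B V X).2.2 ↔
      (Holds X φ ∨ Holds X φ.neg) ∨ ∃ t : Term, t.Closed ∧ φ = .pa t := by
  simp [jump, hφ, PSentences, Holds, eq_comm (b := φ)]

/-- All four components are defined by satisfaction of formulas, which is monotone; the added set
`PSentences` is constant. -/
theorem monotone_jump (B V : Fml) : Monotone (jump B V) := fun _ _ h =>
  ⟨⟨fun _ ⟨φ, h1, h2, h3⟩ => ⟨φ, h1, h2, Sat.mono h h3⟩,
    fun _ ⟨φ, h1, h2, h3⟩ => ⟨φ, h1, h2, Sat.mono h h3⟩⟩,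
    fun _ ⟨φ, h1, h2, h3⟩ => ⟨φ, h1, h2, Sat.mono h h3⟩,
    Set.union_subset_union_left _ fun _ ⟨φ, h1, h2, h3⟩ => ⟨φ, h1, h2, Sat.mono h h3⟩⟩

end Interpretation

/-! ### Paradoxical sentences have no truth value -/

theorem Fml.IsSentence.inst_all {v : ℕ} {φ : Fml} (h : (Fml.all v φ).IsSentence) (n : ℕ) :
    (φ.subst v (numeral n)).IsSentence := (Fml.fv_subst_numeral φ v n).trans h

theorem Fml.IsSentence.inst_ex {v : ℕ} {φ : Fml} (h : (Fml.ex v φ).IsSentence) (n : ℕ) :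
    (φ.subst v (numeral n)).IsSentence := (Fml.fv_subst_numeral φ v n).trans h

theorem holds_all {X : Interp} {v : ℕ} {φ : Fml} :
    Holds X (.all v φ) ↔ ∀ n, Holds X (φ.subst v (numeral n)) :=
  forall_congr' fun n => (Sat.subst_numeral v n _).symm

theorem holds_ex {X : Interp} {v : ℕ} {φ : Fml} :
    Holds X (.ex v φ) ↔ ∃ n, Holds X (φ.subst v (numeral n)) :=
  exists_congr fun n => (Sat.subst_numeral v n _).symm

theorem Fml.isSentence_left {φ ψ : Fml} (h : φ.fv ∪ ψ.fv = ∅) : φ.IsSentence :=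
  (Finset.union_eq_empty.1 h).1

theorem Fml.isSentence_right {φ ψ : Fml} (h : φ.fv ∪ ψ.fv = ∅) : ψ.IsSentence :=
  (Finset.union_eq_empty.1 h).2

/-- Consistent interpretations in which no paradoxical sentence has a truth value. -/
def Sound (X : Interp) : Prop :=
  Consistent X ∧ ∀ n ∈ X.2.1, n ∉ X.1.1 ∧ n ∉ X.1.2

variable {B V : Fml} {X : Interp}

/-- The liar argument. If `φ` holds, its code is in the anti-extension of `T`, which by `X ≤ jump B
V X` means that `¬φ` holds as well; dually for `¬φ`. -/
theorem BaseParadoxical.not_holds {φ : Fml} (h : BaseParadoxical φ) (hX : Consistent X)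
    (hle : X ≤ jump B V X) : ¬ Holds X φ ∧ ¬ Holds X φ.neg := by
  have h1 := h.holds_iff hX
  constructor
  · intro hs
    exact hX.not_sat_neg hs ((mem_jump_ntr h.1).1 (hle.1.2 (h1.1.1 hs)))
  · intro hs
    exact hX.not_sat_neg ((mem_jump_tr h.1).1 (hle.1.1 (h1.2.1 hs))) hs

/-- Induction on `φ.size`. Membership in the present extension of `P` implies membership in the next
one, so the induction hypothesis applies to paradoxical components. -/
theorem not_holds_of_mem_jump_pa (hB : DefinesBase B) (hV : DefinesVal V) (hX : Sound X)
    (hle : X ≤ jump B V X) {φ : Fml} (hφ : φ.IsSentence) (h : φ.code ∈ (jump B V X).2.1) :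
    ¬ Holds X φ ∧ ¬ Holds X φ.neg := by
  induction hs : φ.size using Nat.strong_induction_on generalizing φ with
  | _ s ih =>
  subst hs
  -- What the three kinds of components contribute: paradoxical ones lack a truth value, true ones
  -- are not false, false ones are not true.
  have hP : ∀ {ψ : Fml}, ψ.size < φ.size → ψ.IsSentence → ψ.code ∈ X.2.1 →
      ¬ Holds X ψ ∧ ¬ Holds X ψ.neg := fun h1 h2 h3 => ih _ h1 h2 (hle.2.1 h3) rfl
  have hT : ∀ {ψ : Fml}, ψ.IsSentence → ψ.code ∈ X.1.1 → ¬ Holds X ψ.neg :=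
    fun h1 h2 => hX.1.not_sat_neg ((mem_jump_tr h1).1 (hle.1.1 h2))
  have hF : ∀ {ψ : Fml}, ψ.IsSentence → ψ.code ∈ X.1.2 → ¬ Holds X ψ :=
    fun h1 h2 h3 => hX.1.not_sat_neg h3 ((mem_jump_ntr h1).1 (hle.1.2 h2))
  rcases (mem_jump_pa hB hV hφ).1 h with (h | h) | h
  · exact h.not_holds hX.1 hle
  · simpa [and_comm] using h.not_holds hX.1 hle
  cases φ with
  -- No induction is needed: truth and falsity of `T t` are membership of the value of `t` in the
  -- two sets for `T`, and `Sound` excludes both for paradoxical values.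
  | tr t => exact hX.2 _ h
  | ntr t => exact (hX.2 _ h).symm
  | and ψ χ =>
    have hψ := Fml.isSentence_left hφ
    have hχ := Fml.isSentence_right hφ
    have h1 := hP (ψ := ψ) (by rw [Fml.size]; omega) hψ
    have h2 := hP (ψ := χ) (by rw [Fml.size]; omega) hχ
    have h3 := hT hψ
    have h4 := hT hχ
    simp only [CompPara, ConnPara, Holds, Fml.neg, sat_and, sat_or] at *
    tauto
  | or ψ χ =>
    have hψ := Fml.isSentence_left hφ
    have hχ := Fml.isSentence_right hφ
    have h1 := hP (ψ := ψ) (by rw [Fml.size]; omega) hψ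
    have h2 := hP (ψ := χ) (by rw [Fml.size]; omega) hχ
    have h3 := hF hψ
    have h4 := hF hχ
    simp only [CompPara, ConnPara, Holds, Fml.neg, sat_and, sat_or] at *
    tauto
  | all v ψ =>
    have hlt : ∀ n, (ψ.subst v (numeral n)).size < (Fml.all v ψ).size := fun n => by
      simp [Fml.size, Fml.size_subst]
    obtain ⟨⟨n, hn⟩, h⟩ := h
    rw [Fml.neg, holds_all, holds_ex]
    -- A paradoxical instance prevents the universal sentence from being true. A false instance
    -- would have to be paradoxical or true, and it can be neither.
    refine ⟨fun hs => (hP (hlt n) (hφ.inst_all n) hn).1 (hs n), ?_⟩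
    rintro ⟨m, hm⟩
    rw [← Fml.neg_subst] at hm
    rcases h m with h | h
    · exact (hP (hlt m) (hφ.inst_all m) h).2 hm
    · exact hT (hφ.inst_all m) h hm
  | ex v ψ =>
    have hlt : ∀ n, (ψ.subst v (numeral n)).size < (Fml.ex v ψ).size := fun n => by
      simp [Fml.size, Fml.size_subst]
    obtain ⟨⟨n, hn⟩, h⟩ := h
    rw [Fml.neg, holds_all, holds_ex]
    refine ⟨?_, fun hs => (hP (hlt n) (hφ.inst_ex n) hn).2 (Fml.neg_subst .. ▸ hs n)⟩
    rintro ⟨m, hm⟩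
    rcases h m with h | h
    · exact (hP (hlt m) (hφ.inst_ex m) h).1 hm
    · exact hF (hφ.inst_ex m) h hm
  | _ => exact h.elim

/-- A sentence in both sets for `P` would be paradoxical and either have a truth value, against the
previous lemma, or be of the form `P t`. -/
theorem Sound.jump (hB : DefinesBase B) (hV : DefinesVal V) (hX : Sound X)
    (hle : X ≤ jump B V X) : Sound (jump B V X) := by
  have key := fun φ hφ => not_holds_of_mem_jump_pa hB hV hX hle (φ := φ) hφ
  refine ⟨⟨Set.disjoint_left.2 ?_, Set.disjoint_left.2 ?_⟩, ?_⟩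
  · rintro _ ⟨φ, hφ, rfl, hs⟩ h
    exact hX.1.not_sat_neg hs ((mem_jump_ntr hφ).1 h)
  · rintro _ h (⟨φ, hφ, rfl, h1 | h1⟩ | ⟨t, ht, rfl⟩)
    · exact (key φ hφ h).1 h1
    · exact (key φ hφ h).2 h1
    -- For `P t` there is no closure clause besides `Π`, and neither `P t` nor `¬P t` is base
    -- paradoxical.
    · have := (mem_jump_pa hB hV (φ := .pa t) ht).1 h
      simp [Fml.neg, not_baseParadoxical_pa, not_baseParadoxical_npa, CompPara] at this
  · rintro _ ⟨φ, hφ, rfl, h⟩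
    have := key φ hφ ⟨φ, hφ, rfl, h⟩
    rwa [mem_jump_tr hφ, mem_jump_ntr hφ]

/-! ### The transfinite sequence -/

theorem stage_zero (B V : Fml) : stage B V 0 = ((∅, ∅), (∅, PSentences)) :=
  Ordinal.limitRecOn_zero ..

theorem stage_succ (B V : Fml) (α : Ordinal.{0}) :
    stage B V (α + 1) = jump B V (stage B V α) :=
  Ordinal.limitRecOn_add_one ..

theorem stage_limit (B V : Fml) {l : Ordinal.{0}} (hl : Order.IsSuccLimit l) :
    stage B V l = ⨆ β : Set.Iio l, stage B V β :=
  Ordinal.limitRecOn_limit _ _ _ _ hl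

/-- Holds for arbitrary `X` because the jump adds `PSentences` by fiat. It starts the induction both
for the growth of the stages and for their minimality. -/
theorem stage_zero_le_jump (B V : Fml) (X : Interp) : stage B V 0 ≤ jump B V X := by
  rw [stage_zero]
  exact ⟨⟨Set.empty_subset _, Set.empty_subset _⟩, Set.empty_subset _, Set.subset_union_right⟩

theorem stage_le_limit (B V : Fml) {β l : Ordinal.{0}} (hl : Order.IsSuccLimit l) (h : β < l) :
    stage B V β ≤ stage B V l := by
  rw [stage_limit B V hl]
  exact le_iSup (fun β : Set.Iio l => stage B V β) ⟨β, h⟩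

theorem stage_le_jump (B V : Fml) (α : Ordinal.{0}) :
    stage B V α ≤ jump B V (stage B V α) := by
  induction α using Ordinal.limitRecOn with
  | zero => exact stage_zero_le_jump B V _
  | add_one α ih =>
    rw [stage_succ]
    exact monotone_jump B V ih
  | limit l hl ih =>
    nth_rw 1 [stage_limit B V hl]
    exact iSup_le fun β => (ih β β.2).trans (monotone_jump B V (stage_le_limit B V hl β.2))

theorem monotone_stage (B V : Fml) : Monotone (stage B V) := by
  intro β α h
  induction α using Ordinal.limitRecOn with
  | zero => rw [nonpos_iff_eq_zero.1 h]
  | add_one α ih =>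
    rcases h.eq_or_lt with rfl | h
    · exact le_rfl
    · rw [stage_succ]
      exact (ih (Order.lt_add_one_iff.1 h)).trans (stage_le_jump B V α)
  | limit l hl _ =>
    rcases h.eq_or_lt with rfl | h
    · exact le_rfl
    · exact stage_le_limit B V hl h

theorem stage_le_of_jump_eq {Y : Interp} (hY : jump B V Y = Y) (α : Ordinal.{0}) :
    stage B V α ≤ Y := by
  induction α using Ordinal.limitRecOn with
  | zero => exact hY ▸ stage_zero_le_jump B V Y
  | add_one α ih =>
    rw [stage_succ, ← hY]
    exact monotone_jump B V ih
  | limit l hl ih =>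
    rw [stage_limit B V hl]
    exact iSup_le fun β => ih β β.2

/-- By cardinality two stages `α < β` coincide, and stage `α + 1` is squeezed between them. -/
theorem exists_jump_stage_eq (B V : Fml) : ∃ α, jump B V (stage B V α) = stage B V α := by
  have h := not_injective_of_ordinal (stage B V)
  simp only [Function.Injective, not_forall] at h
  obtain ⟨α, β, h, hne⟩ := h
  wlog hlt : α < β generalizing α β
  · exact this β α h.symm (Ne.symm hne) (lt_of_le_of_ne (not_lt.1 hlt) (Ne.symm hne))
  refine ⟨α, le_antisymm ?_ (stage_le_jump B V α)⟩
  rw [← stage_succ]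
  exact (monotone_stage B V (Order.add_one_le_of_lt hlt)).trans h.ge

theorem sound_stage (hB : DefinesBase B) (hV : DefinesVal V) (α : Ordinal.{0}) :
    Sound (stage B V α) := by
  induction α using Ordinal.limitRecOn with
  | zero => simp [stage_zero, Sound, Consistent]
  | add_one α ih =>
    rw [stage_succ]
    exact ih.jump hB hV (stage_le_jump B V α)
  | limit l hl ih =>
    -- A violation at a limit involves two memberships; since the stages form a chain, both already
    -- occur at a common earlier stage.
    have hdir : ∀ β₁ β₂ : Set.Iio l, ∃ γ : Set.Iio l,
        stage B V β₁ ≤ stage B V γ ∧ stage B V β₂ ≤ stage B V γ := fun β₁ β₂ =>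
      ⟨β₁ ⊔ β₂, monotone_stage B V le_sup_left, monotone_stage B V le_sup_right⟩
    simp only [stage_limit B V hl, Sound, Consistent, Prod.fst_iSup, Prod.snd_iSup,
      Set.iSup_eq_iUnion, Set.disjoint_left, Set.mem_iUnion, not_exists]
    refine ⟨⟨?_, ?_⟩, ?_⟩
    · rintro n ⟨β₁, h₁⟩ β₂ h₂
      obtain ⟨γ, hγ₁, hγ₂⟩ := hdir β₁ β₂
      exact Set.disjoint_left.1 (ih γ γ.2).1.1 (hγ₁.1.1 h₁) (hγ₂.1.2 h₂)
    · rintro n ⟨β₁, h₁⟩ β₂ h₂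
      obtain ⟨γ, hγ₁, hγ₂⟩ := hdir β₁ β₂
      exact Set.disjoint_left.1 (ih γ γ.2).1.2 (hγ₁.2.1 h₁) (hγ₂.2.2 h₂)
    · rintro n ⟨β₁, h₁⟩
      refine ⟨fun β₂ h₂ => ?_, fun β₂ h₂ => ?_⟩ <;> obtain ⟨γ, hγ₁, hγ₂⟩ := hdir β₁ β₂
      · exact ((ih γ γ.2).2 n (hγ₁.2.1 h₁)).1 (hγ₂.1.1 h₂)
      · exact ((ih γ γ.2).2 n (hγ₁.2.1 h₁)).2 (hγ₂.1.2 h₂)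

/-! ### The principles of `TP⁺` at a fixed point -/

theorem Iff2.valid {C : Finset Fml} {φ ψ : Fml} {Γ Δ : Finset Fml} (h : Iff2 C φ ψ Γ Δ)
    (hC : ∀ e : ℕ → ℕ, (∀ γ ∈ C, Sat X e γ) → (Sat X e φ ↔ Sat X e ψ)) : Valid X Γ Δ := by
  intro e
  rcases h with ⟨rfl, rfl⟩ | ⟨rfl, rfl⟩ <;>
    simp only [Finset.forall_mem_insert, Finset.mem_singleton, exists_eq_left, and_imp]
  · exact fun h hΓ => (hC e hΓ).1 h
  · exact fun h hΓ => (hC e hΓ).2 h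

/-- Each principle is a clause of the jump read at a fixed point, after the free variables have been
replaced by the expressions they code. Consistency plays no role here. -/
theorem TPInit.valid (hB : DefinesBase B) (hV : DefinesVal V) (hX : jump B V X = X)
    {Γ Δ : Finset Fml} (h : TPInit B V Γ Δ) : Valid X Γ Δ := by
  have mT : ∀ {φ : Fml}, φ.IsSentence → (φ.code ∈ X.1.1 ↔ Holds X φ) := fun hφ => by
    -- Only the left side is unfolded once by the jump; the right side keeps speaking of `X` itself.
    conv_lhs => rw [← hX]
    exact mem_jump_tr hφ
  have mF : ∀ {φ : Fml}, φ.IsSentence → (φ.code ∈ X.1.2 ↔ Holds X φ.neg) := fun hφ => by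
    conv_lhs => rw [← hX]
    exact mem_jump_ntr hφ
  have mP : ∀ {φ : Fml}, φ.IsSentence → (φ.code ∈ X.2.1 ↔
      (BaseParadoxical φ ∨ BaseParadoxical φ.neg) ∨ CompPara X φ) := fun hφ => by
    conv_lhs => rw [← hX]
    exact mem_jump_pa hB hV hφ
  cases h with
  | T1_eq h =>
    refine h.valid fun e he => ?_
    simp only [Finset.mem_insert, Finset.mem_singleton, forall_eq_or_imp, forall_eq, sat_ClTm]
      at he
    obtain ⟨⟨t, ht, hte⟩, s, hs, hse⟩ := he
    rw [sat_valEq hV (by simp [Term.fv]) (by simp [Term.fv]) ht hs hte hse]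
    simp only [sat_tr, Term.val_ap2, ← hte, ← hse, F2.eval_eqD, fold_eq]
    exact (mT (φ := .eq t s) (Finset.union_eq_empty.2 ⟨ht, hs⟩)).symm
  | T1_ne h =>
    refine h.valid fun e he => ?_
    simp only [Finset.mem_insert, Finset.mem_singleton, forall_eq_or_imp, forall_eq, sat_ClTm]
      at he
    obtain ⟨⟨t, ht, hte⟩, s, hs, hse⟩ := he
    rw [sat_valNe hV (by simp [Term.fv]) (by simp [Term.fv]) ht hs hte hse]
    simp only [sat_tr, Term.val_ap2, ← hte, ← hse, F2.eval_neD, fold_ne]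
    exact (mT (φ := .ne t s) (Finset.union_eq_empty.2 ⟨ht, hs⟩)).symm
  | T2_pos h =>
    refine h.valid fun e he => ?_
    simp only [Finset.mem_singleton, forall_eq, sat_ClTm] at he
    obtain ⟨t, ht, hte⟩ := he
    rw [sat_litVal hV (by simp [Term.fv]) ht hte fun _ => Iff.rfl]
    simp only [sat_tr, Term.val_ap1, ← hte, F1.eval_paD, fold_pa]
    exact (mT (φ := .pa t) ht).symm
  | T2_neg h =>
    refine h.valid fun e he => ?_
    simp only [Finset.mem_singleton, forall_eq, sat_ClTm] at he
    obtain ⟨t, ht, hte⟩ := he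
    rw [sat_litVal hV (by simp [Term.fv]) ht hte fun _ => Iff.rfl]
    simp only [sat_tr, Term.val_ap1, ← hte, F1.eval_npaD, fold_npa]
    exact (mT (φ := .npa t) ht).symm
  | T3_pos h =>
    refine h.valid fun e he => ?_
    simp only [Finset.mem_singleton, forall_eq, sat_ClTm] at he
    obtain ⟨t, ht, hte⟩ := he
    rw [sat_litVal hV (by simp [Term.fv]) ht hte fun _ => Iff.rfl]
    simp only [sat_tr, Term.val_ap1, ← hte, F1.eval_trD, fold_tr]
    exact (mT (φ := .tr t) ht).symm
  | T3_neg h =>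
    refine h.valid fun e he => ?_
    simp only [Finset.mem_singleton, forall_eq, sat_Sent] at he
    obtain ⟨φ, hφ, hφe⟩ := he
    simp only [sat_tr, sat_ntr, Term.val_ap1, ← hφe, F1.eval_ng, ngN_code]
    rw [mF hφ, mT ((Fml.fv_neg φ).trans hφ)]
  | T4_and h =>
    refine h.valid fun e he => ?_
    simp only [Finset.mem_singleton, forall_eq, sat_Sent, Term.val_ap2, F2.eval_andD,
      Fml.code_eq_and] at he
    obtain ⟨_, hφ, ψ, χ, rfl, hψ, hχ⟩ := he
    simp only [sat_and, sat_tr, Term.val_ap2, F2.eval_andD, ← hψ, ← hχ, fold_and]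
    rw [mT hφ, mT (Fml.isSentence_left hφ), mT (Fml.isSentence_right hφ)]
    rfl
  | T4_or h =>
    refine h.valid fun e he => ?_
    simp only [Finset.mem_singleton, forall_eq, sat_Sent, Term.val_ap2, F2.eval_orD,
      Fml.code_eq_or] at he
    obtain ⟨_, hφ, ψ, χ, rfl, hψ, hχ⟩ := he
    simp only [sat_or, sat_tr, Term.val_ap2, F2.eval_orD, ← hψ, ← hχ, fold_or]
    rw [mT hφ, mT (Fml.isSentence_left hφ), mT (Fml.isSentence_right hφ)]
    rfl
  | T5_all h =>
    refine h.valid fun e he => ?_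
    simp only [Finset.mem_singleton, forall_eq, sat_Sent, Term.val_ap2, F2.eval_allD,
      Fml.code_eq_all] at he
    obtain ⟨_, hφ, v, ψ, rfl, hv, hψ⟩ := he
    simp only [sat_all, sat_tr, val_at' (a := .var 2) (b := .var 3) (by simp [Term.fv])
      (by simp [Term.fv]) hψ.symm hv.symm, Term.val_ap2, F2.eval_allD, ← hψ, ← hv, fold_all]
    rw [mT hφ, holds_all]
    exact forall_congr' fun n => mT (hφ.inst_all n)
  | T5_ex h =>
    refine h.valid fun e he => ?_
    simp only [Finset.mem_singleton, forall_eq, sat_Sent, Term.val_ap2, F2.eval_exD,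
      Fml.code_eq_ex] at he
    obtain ⟨_, hφ, v, ψ, rfl, hv, hψ⟩ := he
    simp only [sat_ex, sat_tr, val_at' (a := .var 2) (b := .var 3) (by simp [Term.fv])
      (by simp [Term.fv]) hψ.symm hv.symm, Term.val_ap2, F2.eval_exD, ← hψ, ← hv, fold_ex]
    rw [mT hφ, holds_ex]
    exact exists_congr fun n => mT (hφ.inst_ex n)
  | P1 =>
    intro e he
    simp only [Finset.mem_insert, Finset.mem_singleton, forall_eq_or_imp, forall_eq, sat_Sent]
      at he
    obtain ⟨⟨φ, hφ, hφe⟩, h⟩ := he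
    rw [sat_Pi hB (by simp [Term.fv]) hφe.symm] at h
    refine ⟨_, Finset.mem_singleton_self _, ?_⟩
    rw [sat_pa, ← hφe, mP hφ]
    exact .inl h
  | P2_T h =>
    refine h.valid fun e he => ?_
    simp only [Finset.mem_singleton, forall_eq, sat_ClTm] at he
    obtain ⟨t, ht, hte⟩ := he
    simp only [sat_pa, Term.val_ap1, ← hte, F1.eval_trD, F1.eval_ntrD, fold_tr, fold_ntr]
    rw [mP (φ := .tr t) ht, mP (φ := .ntr t) ht]
    -- `T t` and `¬T t` share the same closure condition, and the part from `Π` is symmetric under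
    -- negation.
    simp only [CompPara, Fml.neg, or_comm]
  | P2_P h =>
    refine h.valid fun e he => ?_
    simp only [Finset.mem_singleton, forall_eq, sat_ClTm] at he
    obtain ⟨t, ht, hte⟩ := he
    simp only [sat_pa, Term.val_ap1, ← hte, F1.eval_paD, F1.eval_npaD, fold_pa, fold_npa]
    rw [mP (φ := .pa t) ht, mP (φ := .npa t) ht]
    simp only [CompPara, Fml.neg, or_comm]
  | P3 h =>
    refine h.valid fun e he => ?_
    simp only [Finset.mem_singleton, forall_eq, sat_ClTm] at he
    obtain ⟨t, ht, hte⟩ := he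
    have hcode : (Term.ap1 .trD (.var 2)).val e = (Fml.tr t).code := by simp [← hte, fold_tr]
    rw [sat_or, sat_litVal hV (by simp [Term.fv]) ht hte fun _ => Iff.rfl,
      sat_Pi hB (by simp [Term.fv]) hcode, sat_pa, hcode, mP (φ := .tr t) ht, or_comm]
    rfl
  | P4 h =>
    refine h.valid fun e he => ?_
    simp only [Finset.mem_singleton, forall_eq, sat_Sent] at he
    obtain ⟨φ, hφ, hφe⟩ := he
    obtain ⟨ψ, χ, rfl, hψ, hχ⟩ := Fml.code_eq_and.1 hφe
    rw [sat_or, sat_connP (A := X.1.1) fun _ _ => Iff.rfl, sat_Pi hB (by simp [Term.fv]) hφe.symm,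
      sat_pa, ← hφe, mP hφ, or_comm, ← hψ, ← hχ]
    rfl
  | P5 h =>
    refine h.valid fun e he => ?_
    simp only [Finset.mem_singleton, forall_eq, sat_Sent] at he
    obtain ⟨φ, hφ, hφe⟩ := he
    obtain ⟨ψ, χ, rfl, hψ, hχ⟩ := Fml.code_eq_or.1 hφe
    rw [sat_or, sat_connP (A := X.1.2) fun _ _ => Iff.rfl, sat_Pi hB (by simp [Term.fv]) hφe.symm,
      sat_pa, ← hφe, mP hφ, or_comm, ← hψ, ← hχ]
    rfl
  | P6 h =>
    refine h.valid fun e he => ?_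
    simp only [Finset.mem_singleton, forall_eq, sat_Sent] at he
    obtain ⟨φ, hφ, hφe⟩ := he
    obtain ⟨v, ψ, rfl, hv, hψ⟩ := Fml.code_eq_all.1 hφe
    rw [sat_or, sat_quantP (A := X.1.1) (fun _ _ => Iff.rfl) (by simp [Term.fv])
      (by simp [Term.fv]) hψ.symm hv.symm, sat_Pi hB (by simp [Term.fv]) hφe.symm,
      sat_pa, ← hφe, mP hφ, or_comm]
    rfl
  | P7 h =>
    refine h.valid fun e he => ?_
    simp only [Finset.mem_singleton, forall_eq, sat_Sent] at he
    obtain ⟨φ, hφ, hφe⟩ := he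
    obtain ⟨v, ψ, rfl, hv, hψ⟩ := Fml.code_eq_ex.1 hφe
    rw [sat_or, sat_quantP (A := X.1.2) (fun _ _ => Iff.rfl) (by simp [Term.fv])
      (by simp [Term.fv]) hψ.symm hv.symm, sat_Pi hB (by simp [Term.fv]) hφe.symm,
      sat_pa, ← hφe, mP hφ, or_comm]
    rfl
  | I1 =>
    intro e he
    simp only [Finset.mem_insert, Finset.mem_singleton, forall_eq_or_imp, forall_eq, sat_Sent]
      at he
    obtain ⟨⟨φ, hφ, hφe⟩, h⟩ := he
    simp only [sat_tr, Term.val_ap2, Term.val_ap1, F2.eval_orD, F1.eval_ng, ← hφe, ngN_code,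
      fold_or] at h
    rw [mT (φ := .or φ φ.neg) (Finset.union_eq_empty.2 ⟨hφ, (Fml.fv_neg φ).trans hφ⟩)] at h
    refine ⟨_, Finset.mem_singleton_self _, ?_⟩
    rw [sat_npa, ← hφe, ← hX, mem_jump_npa hφ]
    exact .inl h

theorem TPPlusInit.valid (hB : DefinesBase B) (hV : DefinesVal V) (hX : jump B V X = X)
    {Γ Δ : Finset Fml} (h : TPPlusInit B V Γ Δ) : Valid X Γ Δ := by
  cases h with
  | tp h => exact h.valid hB hV hX
  | notPP =>
    intro e he
    simp only [Finset.mem_singleton, forall_eq, sat_ClTm] at he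
    obtain ⟨t, ht, hte⟩ := he
    refine ⟨_, Finset.mem_singleton_self _, ?_⟩
    rw [sat_npa, Term.val_ap1, ← hte, F1.eval_paD, fold_pa, ← hX, mem_jump_npa (φ := .pa t) ht]
    -- The one place where validity of the new principle is decided: `P t` lies in the set added to
    -- the anti-extension.
    exact .inr ⟨t, ht, rfl⟩

end TPPlus

/-! ### The least fixed point as a model -/

theorem mainTheorem4 (B V : TPPlus.Fml)
    (hB : TPPlus.DefinesBase B) (hV : TPPlus.DefinesVal V) :
    ∃ X : TPPlus.Interp,
      IsLeast {Y : TPPlus.Interp | TPPlus.jump B V Y = Y} X ∧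
      (∃ α : Ordinal.{0}, ∀ β, α ≤ β → TPPlus.stage B V β = X) ∧
      TPPlus.Models X (TPPlus.TPplus B V) := by
  obtain ⟨α, hα⟩ := TPPlus.exists_jump_stage_eq B V
  refine ⟨TPPlus.stage B V α, ⟨hα, fun Y hY => TPPlus.stage_le_of_jump_eq hY α⟩,
    -- Every stage lies below every fixed point, in particular below stage `α`; so from `α` on
    -- nothing can be added.
    ⟨α, fun β h => le_antisymm (TPPlus.stage_le_of_jump_eq hα β) (TPPlus.monotone_stage B V h)⟩,
    fun Γ Δ h => ?_⟩
  exact h.valid (TPPlus.sound_stage hB hV α).1 fun Γ Δ h => h.valid hB hV hα
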